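/- **Setting.** Let $\mathcal A$ be a unital C*-algebra and $\Lambda$ a set (the lattice). To every finite $X\subset\Lambda$ let a finite-dimensional unital *-subalgebra $\mathcal A(X)\subset\mathcal A$ be given such that $\mathcal A(X)\subseteq\mathcal A(Y)$ if $X\subseteq Y$, $[\mathcal A(X),\mathcal A(Y)]=0$ if $X\cap Y=\emptyset$, and $\bigcup_X\mathcal A(X)$ generates $\mathcal A$ as a C*-algebra. For an arbitrary $S\subseteq\Lambda$, $\mathcal A(S)$ is the C*-algebra generated by all $\mathcal A(X)$ with $X\subseteq S$ finite. Let $\Lambda=\Lambda_A\sqcup\Lambda_B$. Let $(\tau_t)_{t\in\mathbb R}$ be a strongly continuous one-parameter group of *-automorphisms of $\mathcal A$. Let $\Lambda_n\subset\Lambda$, $n\in\mathbb N$, be finite regions such that every finite region is contained in $\Lambda_n$ for all sufficiently large $n$. Let $H_n=H_n^*\in\mathcal A(\Lambda_n)$ and $\tau^{(n)}_t(a)=e^{itH_n}ae^{-itH_n}$, and suppose that $\lim_n\|\tau^{(n)}_t(a)-\tau_t(a)\|=0$ for all $t\in\mathbb R$, $a\in\mathcal A$. A state $\omega$ is a *ground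 state* of a dynamics with generator $\delta=\frac{d}{dt}\tau_t|_{t=0}$ if $-i\,\omega(a^*\delta(a))\ge 0$ for all $a$ in the domain of $\delta$. A state on $\mathcal A(\Lambda_n)$ is a ground state of $H_n$ if it is one for $\tau^{(n)}$ on $\mathcal A(\Lambda_n)$, i.e. $\omega(a^*[H_n,a])\ge0$ for all $a\in\mathcal A(\Lambda_n)$. Let $\omega$ be a ground state of $\tau$ on $\mathcal A$ with GNS representation $(\pi_\omega,\mathcal H,\Omega)$, and put $\mathcal M_A=\pi_\omega(\mathcal A(\Lambda_A))''$, $\mathcal M_B=\pi_\omega(\mathcal A(\Lambda_B))''$. Suppose that $\pi_\omega$ is faithful and that Haag duality $\mathcal M_B=\mathcal M_A'$ holds. For every $n$ let $\omega^{(n)}$ be a pure ground state of $H_n$ on $\mathcal A(\Lambda_n)$ with GNS representation $(\pi_n,\mathcal H_n,\Omega_n)$, put $\mathcal M^{(n)}_{A}=\pi_n(\mathcal A(\Lambda_n\cap\Lambda_A))$, $\mathcal M^{(n)}_{B}=\pi_n(\mathcal A(\Lambda_n\cap\Lambda_B))$, and suppose that $\mathcal M^{(n)}_{B}=(\mathcal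 M^{(n)}_{A})'$. A unit vector $\Omega\in\mathcal H$ is *embezzling* for $(\mathcal M_A,\mathcal M_B,\mathcal H)$ if for all $d\ge1$, $\varepsilon>0$ and unit vectors $\Psi\in\mathbb C^d\otimes\mathbb C^d$ there are unitaries $u\in\mathcal M_A\otimes M_d(\mathbb C)\otimes 1$ and $v\in\mathcal M_B\otimes1\otimes M_d(\mathbb C)$ with $\|uv(\Omega\otimes|0\rangle|0\rangle)-\Omega\otimes\Psi\|<\varepsilon$, where $|0\rangle$ is the first basis vector of $\mathbb C^d$. A sequence of unit vectors $\Omega_n\in\mathcal H_n$ in finite-dimensional bipartite systems $(\mathcal M_{A_n},\mathcal M_{B_n},\mathcal H_n)$, i.e. with $\dim\mathcal H_n<\infty$ and $\mathcal M_{B_n}=\mathcal M_{A_n}'$, is a *bipartite embezzling family* if for all $d\ge1$ and $\varepsilon>0$ there is $n(\varepsilon,d)$ such that for all $n\ge n(\varepsilon,d)$ and all unit vectors $\Psi\in\mathbb C^d\otimes\mathbb C^d$ there are unitaries $u\in\mathcal M_{A_n}\otimes M_d(\mathbb C)\otimes1$ and $v\in\mathcal M_{B_n}\otimes1\otimes M_d(\mathbb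 C)$ with $\|\Omega_n\otimes|0\rangle|0\rangle-uv(\Omega_n\otimes\Psi)\|<\varepsilon$. **Statement.** Suppose that $\omega$ is the unique ground state of $\tau$ on $\mathcal A$ and that its GNS vector $\Omega$ is embezzling for $(\mathcal M_A,\mathcal M_B,\mathcal H)$. Then there are indices $n_1<n_2<\cdots$ such that the sequence of bipartite systems $(\mathcal M^{(n_j)}_{A},\mathcal M^{(n_j)}_{B},\mathcal H_{n_j})$ with the vectors $\Omega_{n_j}$ is a bipartite embezzling family. -/

import Mathlib

open Filter Topology
open scoped ComplexOrder

section SubalgebraOrder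

/-- A closed star-subalgebra of a unital C⋆-algebra, with the order inherited from the ambient
algebra, is again a star-ordered ring, so that states on it make sense. -/
instance closedStarSubalgebra_starOrderedRing {A : Type*} [CStarAlgebra A] [PartialOrder A]
    [StarOrderedRing A] (S : StarSubalgebra ℂ A) [hS : IsClosed (S : Set A)] :
    StarOrderedRing S := by
  have key : ∀ (T : Type _) [CStarAlgebra T] (x : T), IsSelfAdjoint x →
      SpectrumRestricts x ContinuousMap.realToNNReal → ∃ s : T, x = star s * s := by
    intro T _ x hx hr
    let _ := CStarAlgebra.spectralOrder T
    have := CStarAlgebra.spectralOrderedRing T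
    have h0 : 0 ≤ x := by
      rw [StarOrderedRing.nonneg_iff_spectrum_nonneg (R := ℝ) x]
      exact SpectrumRestricts.nnreal_iff.mp hr
    exact CStarAlgebra.nonneg_iff_eq_star_mul_self.mp h0
  refine StarOrderedRing.of_nonneg_iff' ?_ ?_
  · intro x y hxy z
    exact Subtype.coe_le_coe.mp (by simpa using hxy)
  · intro x
    constructor
    · intro hx
      have hxA : (0 : A) ≤ (x : A) := hx
      have hsa : IsSelfAdjoint x := by
        have h := IsSelfAdjoint.of_nonneg hxA
        exact Subtype.ext h
      refine key S x hsa ?_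
      rw [SpectrumRestricts.nnreal_iff]
      intro r hr
      have hr' : (r : ℂ) ∈ spectrum ℂ x := by
        simpa using (spectrum.algebraMap_mem_iff ℂ).mpr hr
      rw [StarSubalgebra.spectrum_eq] at hr'
      have hr2 : r ∈ spectrum ℝ (x : A) := by
        rw [← spectrum.algebraMap_mem_iff ℂ]
        simpa using hr'
      exact (StarOrderedRing.nonneg_iff_spectrum_nonneg (R := ℝ) (x : A)).mp hxA r hr2
    · rintro ⟨s, rfl⟩
      exact star_mul_self_nonneg (s : A)

end SubalgebraOrder

section States

variable {A : Type*} [CStarAlgebra A] [PartialOrder A]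

/-- A state is a positive linear functional with value `1` at the unit. -/
def IsState (ω : A →ₚ[ℂ] ℂ) : Prop := ω 1 = 1

/-- A pure state: an extreme point of the set of states. -/
def IsPureState (ω : A →ₚ[ℂ] ℂ) : Prop :=
  IsState ω ∧ ∀ (φ ψ : A →ₚ[ℂ] ℂ) (t : ℝ), IsState φ → IsState ψ → 0 < t → t < 1 →
    (∀ a, ω a = (t : ℂ) * φ a + ((1 - t : ℝ) : ℂ) * ψ a) → φ = ω ∧ ψ = ω

/-- The vector of the GNS representation that implements the functional, i.e. the class of `1`. -/
noncomputable def gnsVector [StarOrderedRing A] (ω : A →ₚ[ℂ] ℂ) : ω.GNS :=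
  ((ω.toPreGNS 1 : ω.PreGNS) : ω.GNS)

end States

section Dynamics

/-- A C⋆-dynamics: a strongly continuous one-parameter group of automorphisms. -/
structure CStarDynamics (A : Type*) [CStarAlgebra A] where
  aut : ℝ → (A ≃⋆ₐ[ℂ] A)
  aut_zero : ∀ a, aut 0 a = a
  aut_add : ∀ s t a, aut (s + t) a = aut s (aut t a)
  continuous_orbit : ∀ a, Continuous fun t : ℝ => aut t a

/-- The dynamics `a ↦ e^{ith} a e^{-ith}` generated by a bounded Hamiltonian `h`. -/
noncomputable def hamiltonianDynamics {A : Type*} [CStarAlgebra A] (h : A) (t : ℝ) (a : A) : A :=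
  NormedSpace.exp (((t : ℂ) * Complex.I) • h) * a * NormedSpace.exp (-(((t : ℂ) * Complex.I) • h))

/-- `ω` is a ground state for the dynamics `τ`: `-i ω(a⋆ δ(a)) ≥ 0` for every `a` in the domain of
the generator `δ(a) = d/dt τ_t(a)|_{t=0}`; `HasDerivAt` below says that `a` lies in the domain and
that `δ(a) = b`. -/
def IsGroundState {A : Type*} [CStarAlgebra A] [PartialOrder A] (τ : ℝ → A → A)
    (ω : A →ₚ[ℂ] ℂ) : Prop :=
  ∀ a b : A, HasDerivAt (fun t : ℝ => τ t a) b 0 → 0 ≤ -Complex.I * ω (star a * b)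

end Dynamics

section QuasiLocal

/-- The structure of a quasi-local algebra on `A` over a lattice `Λ`: an isotonous net of
finite-dimensional unital star-subalgebras indexed by finite regions, commuting for disjoint
regions, which together generate `A` as a C⋆-algebra. -/
structure QuasiLocalStructure (Λ A : Type*) [CStarAlgebra A] where
  loc : Finset Λ → StarSubalgebra ℂ A
  mono : ∀ X Y, X ⊆ Y → loc X ≤ loc Y
  commute : ∀ X Y, Disjoint X Y → ∀ a ∈ loc X, ∀ b ∈ loc Y, a * b = b * a
  finiteDimensional : ∀ X, FiniteDimensional ℂ (loc X)
  generates : (⨆ X, loc X).topologicalClosure = ⊤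

variable {Λ A : Type*} [CStarAlgebra A]

namespace QuasiLocalStructure

instance isClosed_loc (L : QuasiLocalStructure Λ A) (X : Finset Λ) :
    IsClosed (L.loc X : Set A) := by
  have : FiniteDimensional ℂ (Subalgebra.toSubmodule (L.loc X).toSubalgebra) :=
    L.finiteDimensional X
  exact Submodule.closed_of_finiteDimensional (Subalgebra.toSubmodule (L.loc X).toSubalgebra)

/-- The C⋆-algebra of an arbitrary region, generated by the finite regions that it contains. -/
noncomputable def region (L : QuasiLocalStructure Λ A) (S : Set Λ) : StarSubalgebra ℂ A :=
  (⨆ X : {X : Finset Λ // (X : Set Λ) ⊆ S}, L.loc X.1).topologicalClosure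

open Classical in
/-- The algebra of `X ∩ S`, for `X` finite, as a subalgebra of the algebra of `X`. -/
noncomputable def part (L : QuasiLocalStructure Λ A) (X : Finset Λ) (S : Set Λ) :
    StarSubalgebra ℂ (L.loc X) :=
  (L.loc (X.filter (· ∈ S))).comap (L.loc X).subtype

end QuasiLocalStructure

end QuasiLocal

section Embezzlement

variable {H : Type*} [NormedAddCommGroup H] [InnerProductSpace ℂ H]

/-- The von Neumann algebra `M''` generated by a star-algebra `M` of operators. -/
noncomputable def doubleCommutant [CompleteSpace H] (M : StarSubalgebra ℂ (H →L[ℂ] H)) :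
    StarSubalgebra ℂ (H →L[ℂ] H) :=
  StarSubalgebra.centralizer ℂ
    (StarSubalgebra.centralizer ℂ (M : Set (H →L[ℂ] H)) : Set (H →L[ℂ] H))

/-- Haag duality `MB = MA'`. -/
def HaagDuality [CompleteSpace H] (MA MB : StarSubalgebra ℂ (H →L[ℂ] H)) : Prop :=
  (MB : Set (H →L[ℂ] H)) = Set.centralizer (MA : Set (H →L[ℂ] H))

/-- The Hilbert space `H ⊗ ℂ^d ⊗ ℂ^d`, written as the `ℓ²`-sum of copies of `H` indexed by pairs
`(i, j)`, with `i` for the system `A'` and `j` for the system `B'`. -/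
abbrev Amplified (H : Type*) [NormedAddCommGroup H] (d : ℕ) : Type _ :=
  PiLp 2 (fun _ : Fin d × Fin d => H)

/-- The product vector `Ω ⊗ Ψ`. -/
noncomputable def tensorVector {d : ℕ} (Ω : H) (Ψ : EuclideanSpace ℂ (Fin d × Fin d)) :
    Amplified H d :=
  WithLp.toLp 2 fun p => Ψ p • Ω

/-- The product vector `|0⟩|0⟩` in `ℂ^d ⊗ ℂ^d`. -/
noncomputable def zeroZero (d : ℕ) [NeZero d] : EuclideanSpace ℂ (Fin d × Fin d) :=
  EuclideanSpace.single ((0 : Fin d), (0 : Fin d)) (1 : ℂ)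

variable [CompleteSpace H]

/-- The action on `H ⊗ ℂ^d ⊗ ℂ^d` of an element of `M ⊗ M_d(ℂ) ⊗ 1`, given as a `d × d` matrix
with entries in `M`. -/
noncomputable def actA {M : StarSubalgebra ℂ (H →L[ℂ] H)} {d : ℕ} (u : Matrix (Fin d) (Fin d) M)
    (ξ : Amplified H d) : Amplified H d :=
  WithLp.toLp 2 fun p => ∑ k, (u p.1 k : H →L[ℂ] H) (ξ (k, p.2))

/-- The action on `H ⊗ ℂ^d ⊗ ℂ^d` of an element of `M ⊗ 1 ⊗ M_d(ℂ)`, given as a `d × d` matrix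
with entries in `M`. -/
noncomputable def actB {M : StarSubalgebra ℂ (H →L[ℂ] H)} {d : ℕ} (u : Matrix (Fin d) (Fin d) M)
    (ξ : Amplified H d) : Amplified H d :=
  WithLp.toLp 2 fun p => ∑ k, (u p.2 k : H →L[ℂ] H) (ξ (p.1, k))

/-- `Ω` is an embezzling state for the pair `(MA, MB)`: every state vector `Ψ` in `ℂ^d ⊗ ℂ^d` can
be embezzled from it by local unitaries, up to an arbitrarily small error. -/
def IsEmbezzling (MA MB : StarSubalgebra ℂ (H →L[ℂ] H)) (Ω : H) : Prop :=
  ∀ (d : ℕ) [NeZero d] (ε : ℝ), 0 < ε →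
    ∀ Ψ : EuclideanSpace ℂ (Fin d × Fin d), ‖Ψ‖ = 1 →
      ∃ u ∈ unitary (Matrix (Fin d) (Fin d) MA), ∃ v ∈ unitary (Matrix (Fin d) (Fin d) MB),
        ‖actA u (actB v (tensorVector Ω (zeroZero d))) - tensorVector Ω Ψ‖ < ε

end Embezzlement

/-- A bipartite embezzling family: a sequence of unit vectors in finite-dimensional bipartite
systems such that, for every dimension and error, every state vector of that dimension can be
embezzled up to that error from all late enough members of the sequence. -/
structure IsBipartiteEmbezzlingFamily {H : ℕ → Type*} [∀ n, NormedAddCommGroup (H n)]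
    [∀ n, InnerProductSpace ℂ (H n)] [∀ n, CompleteSpace (H n)]
    (MA MB : ∀ n, StarSubalgebra ℂ (H n →L[ℂ] H n)) (Ω : ∀ n, H n) : Prop where
  finiteDimensional : ∀ n, FiniteDimensional ℂ (H n)
  haagDuality : ∀ n, HaagDuality (MA n) (MB n)
  norm_eq_one : ∀ n, ‖Ω n‖ = 1
  embezzles : ∀ (d : ℕ) [NeZero d] (ε : ℝ), 0 < ε → ∃ N : ℕ, ∀ n, N ≤ n →
    ∀ Ψ : EuclideanSpace ℂ (Fin d × Fin d), ‖Ψ‖ = 1 →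
      ∃ u ∈ unitary (Matrix (Fin d) (Fin d) (MA n)),
        ∃ v ∈ unitary (Matrix (Fin d) (Fin d) (MB n)),
          ‖tensorVector (Ω n) (zeroZero d) - actA u (actB v (tensorVector (Ω n) Ψ))‖ < ε

section LatticeBipartition

variable {Λ A : Type*} [CStarAlgebra A] [PartialOrder A] [StarOrderedRing A]

/-- The von Neumann algebra `π_ω(𝒜(S))''` of a region `S` in the GNS representation of `ω`. -/
noncomputable def gnsRegionAlgebra (L : QuasiLocalStructure Λ A) (ω : A →ₚ[ℂ] ℂ) (S : Set Λ) :
    StarSubalgebra ℂ (ω.GNS →L[ℂ] ω.GNS) :=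
  doubleCommutant ((L.region S).map ω.gnsStarAlgHom)

/-- The algebra `π_φ(𝒜(X ∩ S))` in the GNS representation of a functional `φ` on `𝒜(X)`. -/
noncomputable def gnsLocalAlgebra (L : QuasiLocalStructure Λ A) {X : Finset Λ}
    (φ : L.loc X →ₚ[ℂ] ℂ) (S : Set Λ) : StarSubalgebra ℂ (φ.GNS →L[ℂ] φ.GNS) :=
  (L.part X S).map φ.gnsStarAlgHom

end LatticeBipartition

/-!
The finite-volume ground states converge to `ω`, and the error of a fixed embezzlement protocol built
from local unitaries depends continuously on the state.

*Convergence of states.* For `a` in the domain of the generator `δ` put `c = a - δ a`, so that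
`a = ∫₀^∞ e^{-t} τ_t(c) dt`. If `cₙ` in `𝒜(Λₙ)` tends to `c`, then the resolvents
`aₙ = ∫₀^∞ e^{-t} τ⁽ⁿ⁾_t(cₙ) dt` stay in `𝒜(Λₙ)`, satisfy `δₙ aₙ = aₙ - cₙ`, and by dominated
convergence `aₙ → a` and `δₙ aₙ → δ a`. The ground state inequality therefore passes to every limit
of the `ω⁽ⁿ⁾` along an ultrafilter (`isGroundState_of_tendsto`). By uniqueness all these limits equal
`ω`, whence `ω⁽ⁿ⁾(aₙ) → ω(a)` whenever `aₙ → a` with `aₙ` local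
(`tendsto_apply_of_unique_groundState`). No subsequence is needed.

*Local unitaries.* The embezzling unitaries lie in matrix algebras over `π(𝒜(S))''`. The bicommutant
theorem, combined with a separation argument for the adjoints, gives local `x` such that `x ξ` is
close to `u ξ` and `x⋆ u ξ` is close to `ξ` (`exists_mem_diagonalOperator_lt`). The unitary factor of
the polar decomposition of `x` is then close to `u` on `ξ` as well (`exists_unitary_apply_sub_le`).
It exists in the finite-dimensional local algebra once `x` has been perturbed to be invertible.

*Transfer.* For local unitaries the squared error `‖u v (Ω ⊗ |0⟩|0⟩) - Ω ⊗ Ψ‖²` is a finite sum of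
values of the state on local elements (`norm_sq_ampA_ampB_sub`), so it converges along the sequence.
Compactness of the unit sphere gives uniformity in `Ψ`, and the adjoints of the unitaries, which
commute by duality, carry `Ω ⊗ Ψ` back to `Ω ⊗ |0⟩|0⟩`.
-/

/-! ### Strong approximation from the bicommutant, and approximation by unitaries -/

section Bicommutant

variable {H : Type*} [NormedAddCommGroup H] [InnerProductSpace ℂ H]
  {ι : Type*} [Fintype ι]

/-- The diagonal operator `T ⊗ 1` on a finite multiple of `H`. -/
noncomputable def diagonalOperator (ι : Type*) [Fintype ι] :
    (H →L[ℂ] H) →ₗ[ℂ] (PiLp 2 (fun _ : ι => H) →L[ℂ] PiLp 2 (fun _ : ι => H)) where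
  toFun T := ((PiLp.continuousLinearEquiv 2 ℂ (fun _ : ι => H)).symm : _ →L[ℂ] _).comp
    (ContinuousLinearMap.pi fun i => T.comp (PiLp.proj 2 (fun _ : ι => H) i))
  map_add' S T := by ext; simp
  map_smul' c T := by ext; simp

@[simp]
lemma diagonalOperator_apply (T : H →L[ℂ] H) (v : PiLp 2 (fun _ : ι => H)) (i : ι) :
    diagonalOperator ι T v i = T (v i) := rfl

variable [CompleteSpace H]

lemma inner_diagonalOperator_left (T : H →L[ℂ] H) (v w : PiLp 2 (fun _ : ι => H)) :
    inner ℂ (diagonalOperator ι (star T) v) w = inner ℂ v (diagonalOperator ι T w) := by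
  simp [PiLp.inner_apply, ContinuousLinearMap.star_eq_adjoint,
    ContinuousLinearMap.adjoint_inner_left]

/-- An operator commuting with the diagonal action of `M` has matrix entries in `M'`, so it
commutes with the diagonal action of `M''`. -/
lemma diagonalOperator_commute_of_mem_doubleCommutant {M : StarSubalgebra ℂ (H →L[ℂ] H)}
    {P : PiLp 2 (fun _ : ι => H) →L[ℂ] PiLp 2 (fun _ : ι => H)}
    (hP : ∀ x ∈ M, ∀ v, P (diagonalOperator ι x v) = diagonalOperator ι x (P v))
    {T : H →L[ℂ] H} (hT : T ∈ doubleCommutant M) (v : PiLp 2 (fun _ : ι => H)) :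
    P (diagonalOperator ι T v) = diagonalOperator ι T (P v) := by
  classical
  -- the coordinate embeddings of `H`, and the matrix entries of `P`
  let incl : ι → (H →L[ℂ] PiLp 2 (fun _ : ι => H)) := fun j =>
    ((PiLp.continuousLinearEquiv 2 ℂ (fun _ : ι => H)).symm : _ →L[ℂ] _).comp
      (ContinuousLinearMap.single ℂ (fun _ : ι => H) j)
  have hincl : ∀ (S : H →L[ℂ] H) (j : ι) (x : H),
      incl j (S x) = diagonalOperator ι S (incl j x) := by
    intro S j x
    ext i
    by_cases hij : i = j
    · subst hij; simp [incl]
    · simp [incl, hij]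
  have hsum : ∀ w : PiLp 2 (fun _ : ι => H), w = ∑ j, incl j (w j) := by
    intro w
    ext i
    simp [incl, Pi.single_apply]
  let entry : ι → ι → (H →L[ℂ] H) := fun i j =>
    (PiLp.proj 2 (fun _ : ι => H) i).comp (P.comp (incl j))
  have hentry : ∀ i j, ∀ x ∈ M, x * entry i j = entry i j * x := by
    intro i j x hx
    ext y
    change x (P (incl j y) i) = P (incl j (x y)) i
    rw [hincl, hP x hx]
    rfl
  have hentry' : ∀ i j, T * entry i j = entry i j * T := by
    intro i j
    refine ((StarSubalgebra.mem_centralizer_iff ℂ).1 hT (entry i j) ?_).1.symm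
    refine (StarSubalgebra.mem_centralizer_iff ℂ).2 fun g hg => ⟨hentry i j g hg, ?_⟩
    exact hentry i j _ (star_mem hg)
  ext i
  have h1 : ∀ w : PiLp 2 (fun _ : ι => H), P w i = ∑ j, entry i j (w j) := by
    intro w
    conv_lhs => rw [hsum w]
    simp [entry, map_sum]
  rw [h1, diagonalOperator_apply, h1, map_sum]
  refine Finset.sum_congr rfl fun j _ => ?_
  exact (congrArg (fun S : H →L[ℂ] H => S (v j)) (hentry' i j)).symm

/-- Density half of the bicommutant theorem: `M''` lies in the strong closure of `M`. -/
lemma diagonalOperator_mem_closure {M : StarSubalgebra ℂ (H →L[ℂ] H)}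
    {T : H →L[ℂ] H} (hT : T ∈ doubleCommutant M) (ξ : PiLp 2 (fun _ : ι => H)) :
    diagonalOperator ι T ξ ∈
      closure ((fun x => diagonalOperator ι x ξ) '' (M : Set (H →L[ℂ] H))) := by
  let ev : (H →L[ℂ] H) →ₗ[ℂ] PiLp 2 (fun _ : ι => H) :=
    ((ContinuousLinearMap.apply ℂ _ ξ : _ →L[ℂ] PiLp 2 (fun _ : ι => H)) :
      _ →ₗ[ℂ] _).comp (diagonalOperator ι)
  let W₀ : Submodule ℂ (PiLp 2 (fun _ : ι => H)) :=
    (Subalgebra.toSubmodule M.toSubalgebra).map ev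
  let W := W₀.topologicalClosure
  have hW : (W : Set (PiLp 2 (fun _ : ι => H))) =
      closure ((fun x => diagonalOperator ι x ξ) '' (M : Set (H →L[ℂ] H))) := by
    rw [Submodule.topologicalClosure_coe]
    rfl
  rw [← hW, SetLike.mem_coe]
  have : CompleteSpace W := W₀.isClosed_topologicalClosure.completeSpace_coe
  have hinv : ∀ x ∈ M, ∀ v ∈ W, diagonalOperator ι x v ∈ W := by
    intro x hx v hv
    refine map_mem_closure (diagonalOperator ι x).continuous hv ?_
    rintro _ ⟨y, hy, rfl⟩
    exact ⟨x * y, M.mul_mem hx hy, rfl⟩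
  have hinv' : ∀ x ∈ M, ∀ v ∈ Wᗮ, diagonalOperator ι x v ∈ Wᗮ := by
    intro x hx v hv
    rw [Submodule.mem_orthogonal] at hv ⊢
    intro u hu
    rw [← inner_diagonalOperator_left]
    exact hv _ (hinv _ (star_mem hx) _ hu)
  have hcomm : ∀ x ∈ M, ∀ v, W.starProjection (diagonalOperator ι x v) =
      diagonalOperator ι x (W.starProjection v) := by
    intro x hx v
    refine Submodule.eq_starProjection_of_mem_orthogonal
      (hinv x hx _ (Submodule.starProjection_apply_mem W v)) ?_
    rw [← map_sub]
    exact hinv' x hx _ (Submodule.sub_starProjection_mem_orthogonal v)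
  have hξ : ξ ∈ W := subset_closure ⟨1, M.one_mem, rfl⟩
  have h := diagonalOperator_commute_of_mem_doubleCommutant hcomm hT ξ
  rw [Submodule.starProjection_eq_self_iff.2 hξ] at h
  rw [← h]
  exact Submodule.starProjection_apply_mem W _

/-- Two real-linear maps are approximated simultaneously on a subspace as soon as every pair
of functionals that annihilates the subspace annihilates `T`: the closure of a subspace is its
double orthogonal complement. -/
lemma exists_mem_sub_lt_of_inner_eq_zero {V E : Type*} [AddCommGroup V] [Module ℝ V]
    [NormedAddCommGroup E] [InnerProductSpace ℝ E] [CompleteSpace E] (N : Submodule ℝ V)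
    (f g : V →ₗ[ℝ] E) (T : V)
    (hw : ∀ ζ ζ' : E, (∀ x ∈ N, inner ℝ ζ (f x) + inner ℝ ζ' (g x) = 0) →
      inner ℝ ζ (f T) + inner ℝ ζ' (g T) = 0) {δ : ℝ} (hδ : 0 < δ) :
    ∃ x ∈ N, ‖f x - f T‖ < δ ∧ ‖g x - g T‖ < δ := by
  -- the pairs of values form a subspace of `E × E`
  let ev : V →ₗ[ℝ] WithLp 2 (E × E) :=
    ((WithLp.linearEquiv 2 ℝ (E × E)).symm : E × E →ₗ[ℝ] _).comp (f.prod g)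
  let R : Submodule ℝ (WithLp 2 (E × E)) := N.map ev
  have hT : ev T ∈ R.topologicalClosure := by
    rw [← Submodule.orthogonal_orthogonal_eq_closure, Submodule.mem_orthogonal]
    intro w hw'
    rw [Submodule.mem_orthogonal'] at hw'
    have := hw w.fst w.snd fun x hx => by
      simpa [ev, WithLp.prod_inner_apply] using hw' (ev x) ⟨x, hx, rfl⟩
    simpa [ev, WithLp.prod_inner_apply] using this
  have hT' : ev T ∈ closure (R : Set (WithLp 2 (E × E))) := hT
  obtain ⟨_, ⟨x, hx, rfl⟩, hd⟩ := Metric.mem_closure_iff.1 hT' δ hδ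
  rw [dist_comm, dist_eq_norm, ← map_sub] at hd
  refine ⟨x, hx, ?_, ?_⟩
  · refine lt_of_le_of_lt ?_ hd
    rw [← map_sub]
    exact WithLp.norm_fst_le E (ev (x - T))
  · refine lt_of_le_of_lt ?_ hd
    rw [← map_sub]
    exact WithLp.norm_snd_le E (ev (x - T))

lemma star_diagonalOperator (T : H →L[ℂ] H) :
    star (diagonalOperator ι T) = diagonalOperator ι (star T) := by
  rw [ContinuousLinearMap.star_eq_adjoint]
  refine ((ContinuousLinearMap.eq_adjoint_iff _ _).2 ?_).symm
  exact fun v w => inner_diagonalOperator_left T v w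

/-- Elements of `M''` are approximated by elements of `M`, on finitely many vectors, simultaneously
with their adjoints. -/
lemma exists_mem_diagonalOperator_lt {M : StarSubalgebra ℂ (H →L[ℂ] H)}
    {T : H →L[ℂ] H} (hT : T ∈ doubleCommutant M) (ξ : PiLp 2 (fun _ : ι => H)) {δ : ℝ}
    (hδ : 0 < δ) :
    ∃ x ∈ M, ‖diagonalOperator ι x ξ - diagonalOperator ι T ξ‖ < δ ∧
      ‖diagonalOperator ι (star x) ξ - diagonalOperator ι (star T) ξ‖ < δ := by
  let f : (H →L[ℂ] H) →ₗ[ℝ] PiLp 2 (fun _ : ι => H) :=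
    { toFun := fun x => diagonalOperator ι x ξ
      map_add' := fun x y => by simp
      map_smul' := fun c x => by ext; simp }
  let g : (H →L[ℂ] H) →ₗ[ℝ] PiLp 2 (fun _ : ι => H) :=
    { toFun := fun x => diagonalOperator ι (star x) ξ
      map_add' := fun x y => by simp
      map_smul' := fun c x => by ext; simp }
  let _ : InnerProductSpace ℝ (PiLp 2 (fun _ : ι => H)) := InnerProductSpace.rclikeToReal ℂ _
  refine exists_mem_sub_lt_of_inner_eq_zero
    ((Subalgebra.toSubmodule M.toSubalgebra).restrictScalars ℝ) f g T (fun ζ ζ' h => ?_) hδ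
  -- moving `x⋆` to the other side, only the action of `x` on the family `(ξ, ζ')` matters
  let θ : PiLp 2 (fun _ : ι ⊕ ι => H) := WithLp.toLp 2 (Sum.elim ξ ζ')
  let F : PiLp 2 (fun _ : ι ⊕ ι => H) → ℝ := fun w =>
    (∑ i, inner ℂ (ζ i) (w (Sum.inl i))).re + (∑ i, inner ℂ (w (Sum.inr i)) (ξ i)).re
  have hF : Continuous F := by
    have h1 : ∀ j, Continuous fun w : PiLp 2 (fun _ : ι ⊕ ι => H) => w j := fun j =>
      (PiLp.proj 2 (𝕜 := ℂ) (fun _ : ι ⊕ ι => H) j).continuous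
    refine (Complex.continuous_re.comp (continuous_finsetSum _ fun i _ => ?_)).add
      (Complex.continuous_re.comp (continuous_finsetSum _ fun i _ => ?_))
    · exact continuous_const.inner (h1 _)
    · exact (h1 _).inner continuous_const
  have hval : ∀ x : H →L[ℂ] H, F (diagonalOperator (ι ⊕ ι) x θ) =
      (inner ℂ ζ (diagonalOperator ι x ξ)).re +
        (inner ℂ ζ' (diagonalOperator ι (star x) ξ)).re := by
    intro x
    rw [← star_diagonalOperator, ContinuousLinearMap.star_eq_adjoint,
      ContinuousLinearMap.adjoint_inner_right,
      PiLp.inner_apply, PiLp.inner_apply]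
    rfl
  change (inner ℂ ζ (diagonalOperator ι T ξ)).re +
    (inner ℂ ζ' (diagonalOperator ι (star T) ξ)).re = 0
  rw [← hval]
  have hcl : IsClosed {w | F w = 0} := isClosed_eq hF continuous_const
  refine closure_minimal ?_ hcl (diagonalOperator_mem_closure hT θ)
  rintro _ ⟨x, hx, rfl⟩
  change F _ = 0
  rw [hval]
  exact h x hx

end Bicommutant

section Polar

/-- In a finite-dimensional algebra every element has invertible perturbations by arbitrarily small
positive multiples of the unit. -/
lemma exists_isUnit_add_smul_one {C : Type*} [Ring C] [Algebra ℂ C] [FiniteDimensional ℂ C]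
    (x : C) {δ : ℝ} (hδ : 0 < δ) : ∃ r : ℝ, 0 < r ∧ r < δ ∧ IsUnit (x + (r : ℂ) • (1 : C)) := by
  have hfin : (spectrum ℂ x).Finite := by
    have hx := Algebra.IsIntegral.isIntegral (R := ℂ) x
    refine ((minpoly ℂ x).rootSet_finite ℂ).subset fun z hz => ?_
    rw [Polynomial.mem_rootSet]
    refine ⟨minpoly.ne_zero hx, ?_⟩
    have h := spectrum.subset_polynomial_aeval x (minpoly ℂ x) ⟨z, hz, rfl⟩
    rw [minpoly.aeval] at h
    by_contra h0
    refine h ?_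
    rw [spectrum.mem_resolventSet_iff, sub_zero]
    simpa using (IsUnit.mk0 _ h0).map (algebraMap ℂ C)
  have hinj : Function.Injective fun r : ℝ => -(r : ℂ) := fun r s h => by simpa using h
  have hfin' := hfin.preimage hinj.injOn
  obtain ⟨r, hr, hr'⟩ := ((Set.Ioo_infinite hδ).sdiff hfin').nonempty
  refine ⟨r, hr.1, hr.2, ?_⟩
  have := spectrum.notMem_iff.1 hr'
  rw [← IsUnit.neg_iff]
  convert this using 1
  rw [Algebra.algebraMap_eq_smul_one]
  simp only [neg_smul, neg_add_rev]
  abel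

/-- If `x` carries `ξ` to `η` and `x⋆` carries `η` back to `ξ`, up to errors `δ`, then so does the
unitary part `w` of the polar decomposition `x = w |x|`: with `ζ = w⋆ η` the two hypotheses give
`‖(1 + |x|) (ξ - ζ)‖ ≤ 2 δ`, and `1 + |x|` is bounded below by `1`. This takes the place of
Kaplansky's density theorem for unitaries. -/
lemma exists_unitary_apply_sub_le {C : Type*} [CStarAlgebra C] {K : Type*} [NormedAddCommGroup K]
    [InnerProductSpace ℂ K] [CompleteSpace K] (ρ : C →⋆ₐ[ℂ] (K →L[ℂ] K)) {x : C} (hx : IsUnit x)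
    {ξ η : K} {δ : ℝ} (h1 : ‖ρ x ξ - η‖ ≤ δ) (h2 : ‖ρ (star x) η - ξ‖ ≤ δ) :
    ∃ w ∈ unitary C, ‖ρ w ξ - η‖ ≤ 2 * δ := by
  let _ := CStarAlgebra.spectralOrder C
  have := CStarAlgebra.spectralOrderedRing C
  let p : C := CFC.abs x
  have hpp : p * p = star x * x := CFC.abs_mul_abs x
  have hp0 : 0 ≤ p := CFC.abs_nonneg x
  have hps : star p = p := (IsSelfAdjoint.of_nonneg hp0).star_eq
  have hpu : IsUnit p := by
    rw [← isUnit_mul_self_iff, hpp]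
    exact hx.star.mul hx
  obtain ⟨q, hq⟩ := hpu
  have hqs : star (↑q⁻¹ : C) = ↑q⁻¹ := by
    rw [← Units.coe_star_inv]
    congr 2
    ext
    rw [Units.coe_star, hq, hps]
  let w : C := x * ↑q⁻¹
  have hw1 : star w * w = 1 := by
    calc star w * w = ↑q⁻¹ * (star x * x) * ↑q⁻¹ := by simp [w, hqs, mul_assoc]
      _ = 1 := by rw [← hpp, ← hq]; simp
  have hwp : w * p = x := by simp [w, ← hq, mul_assoc]
  have hwu : w ∈ unitary C := by
    refine Unitary.mem_iff.2 ⟨hw1, ?_⟩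
    have hwU : IsUnit w := hx.mul q⁻¹.isUnit
    rw [← hwU.mul_left_inj, mul_assoc, hw1, one_mul, mul_one]
  have hwx : star w * x = p := by rw [← hwp, ← mul_assoc, hw1, one_mul]
  have hiso : ∀ y ∈ unitary C, ∀ v, ‖ρ y v‖ = ‖v‖ := fun y hy v =>
    ContinuousLinearMap.norm_map_of_mem_unitary (Unitary.map_mem ρ hy) v
  have hmul : ∀ (y z : C) (v : K), ρ (y * z) v = ρ y (ρ z v) := fun y z v => by
    rw [map_mul]; rfl
  let ζ := ρ (star w) η
  have hwζ : ρ w ζ = η := by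
    rw [← hmul, (Unitary.mem_iff.1 hwu).2, map_one]; rfl
  have e1 : ρ p ξ - ζ = ρ (star w) (ρ x ξ - η) := by
    rw [map_sub, ← hmul, hwx]
  have e2 : ρ (star x) η = ρ p ζ := by
    rw [← hmul, ← hwp, star_mul, hps]
  have n1 : ‖ρ p ξ - ζ‖ ≤ δ := by
    rw [e1, hiso _ (Unitary.star_mem hwu)]; exact h1
  have n2 : ‖ρ p ζ - ξ‖ ≤ δ := e2 ▸ h2
  have hpos : ∀ v : K, 0 ≤ (inner ℂ v (ρ p v)).re := by
    obtain ⟨s, hs⟩ := CStarAlgebra.nonneg_iff_eq_star_mul_self.1 hp0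
    intro v
    rw [hs, hmul, map_star, ContinuousLinearMap.star_eq_adjoint,
      ContinuousLinearMap.adjoint_inner_right]
    exact inner_self_nonneg (𝕜 := ℂ)
  have hbelow : ∀ v : K, ‖v‖ ≤ ‖v + ρ p v‖ := by
    intro v
    rcases eq_or_lt_of_le (norm_nonneg v) with h0 | h0
    · rw [← h0]; exact norm_nonneg _
    have h3 : ‖v‖ * ‖v‖ ≤ (inner ℂ v (v + ρ p v)).re := by
      rw [inner_add_right, Complex.add_re]
      have : (inner ℂ v v : ℂ).re = ‖v‖ * ‖v‖ := by
        simp [sq]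
      rw [this]
      linarith [hpos v]
    have h4 : (inner ℂ v (v + ρ p v)).re ≤ ‖v‖ * ‖v + ρ p v‖ :=
      (Complex.re_le_norm _).trans (norm_inner_le_norm _ _)
    exact le_of_mul_le_mul_left (h3.trans h4) h0
  refine ⟨w, hwu, ?_⟩
  calc ‖ρ w ξ - η‖ = ‖ξ - ζ‖ := by rw [← hwζ, ← map_sub, hiso w hwu]
    _ ≤ ‖ξ - ζ + ρ p (ξ - ζ)‖ := hbelow _
    _ = ‖(ρ p ξ - ζ) - (ρ p ζ - ξ)‖ := by rw [map_sub]; congr 1; abel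
    _ ≤ ‖ρ p ξ - ζ‖ + ‖ρ p ζ - ξ‖ := norm_sub_le _ _
    _ ≤ 2 * δ := by linarith

end Polar

/-! ### Convergence of dynamics and of resolvents -/

section Resolvent

open MeasureTheory Set

variable {A : Type*} [CStarAlgebra A]

lemma exp_smul_I_mem_unitary {h : A} (hh : IsSelfAdjoint h) (t : ℝ) :
    NormedSpace.exp (((t : ℂ) * Complex.I) • h) ∈ unitary A := by
  let +nondep : NormedAlgebra ℚ A := .restrictScalars ℚ ℂ A
  refine NormedSpace.exp_mem_unitary_of_mem_skewAdjoint (hh.smul_mem_skewAdjoint ?_)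
  simp [skewAdjoint.mem_iff]

lemma exp_neg_smul_I_mem_unitary {h : A} (hh : IsSelfAdjoint h) (t : ℝ) :
    NormedSpace.exp (-(((t : ℂ) * Complex.I) • h)) ∈ unitary A := by
  have := exp_smul_I_mem_unitary hh (-t)
  rwa [Complex.ofReal_neg, neg_mul, neg_smul] at this

lemma norm_hamiltonianDynamics {h : A} (hh : IsSelfAdjoint h) (t : ℝ) (a : A) :
    ‖hamiltonianDynamics h t a‖ = ‖a‖ := by
  rw [hamiltonianDynamics, CStarRing.norm_mul_mem_unitary _ (exp_neg_smul_I_mem_unitary hh t),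
    CStarRing.norm_mem_unitary_mul _ (exp_smul_I_mem_unitary hh t)]

lemma hamiltonianDynamics_zero (h a : A) : hamiltonianDynamics h 0 a = a := by
  simp [hamiltonianDynamics]

lemma hamiltonianDynamics_sub (h a b : A) (t : ℝ) :
    hamiltonianDynamics h t (a - b) = hamiltonianDynamics h t a - hamiltonianDynamics h t b := by
  simp [hamiltonianDynamics, mul_sub, sub_mul]

lemma hasDerivAt_hamiltonianDynamics (h a : A) (t : ℝ) :
    HasDerivAt (fun s => hamiltonianDynamics h s a)
      (Complex.I • (h * hamiltonianDynamics h t a - hamiltonianDynamics h t a * h)) t := by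
  have hu : HasDerivAt (fun s : ℝ => NormedSpace.exp (((s : ℂ) * Complex.I) • h))
      ((Complex.I • h) * NormedSpace.exp (((t : ℂ) * Complex.I) • h)) t := by
    simpa [mul_smul, Complex.coe_smul] using
      hasDerivAt_exp_smul_const' (𝕂 := ℝ) (Complex.I • h) t
  have hv : HasDerivAt (fun s : ℝ => NormedSpace.exp (-(((s : ℂ) * Complex.I) • h)))
      (NormedSpace.exp (-(((t : ℂ) * Complex.I) • h)) * (-(Complex.I • h))) t := by
    simpa [mul_smul, Complex.coe_smul] using
      hasDerivAt_exp_smul_const (𝕂 := ℝ) (-(Complex.I • h)) t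
  have := (hu.mul_const a).mul hv
  refine this.congr_deriv ?_
  simp only [hamiltonianDynamics, smul_sub, mul_assoc, smul_mul_assoc, mul_neg, mul_smul_comm]
  abel

lemma continuous_hamiltonianDynamics (h a : A) :
    Continuous fun t => hamiltonianDynamics h t a :=
  continuous_iff_continuousAt.2 fun t => (hasDerivAt_hamiltonianDynamics h a t).continuousAt

lemma coe_hamiltonianDynamics (S : StarSubalgebra ℂ A) [IsClosed (S : Set A)] (h a : S) (t : ℝ) :
    ((hamiltonianDynamics h t a : S) : A) = hamiltonianDynamics (h : A) t (a : A) := by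
  let +nondep : NormedAlgebra ℚ A := .restrictScalars ℚ ℂ A
  let +nondep : NormedAlgebra ℚ S := .restrictScalars ℚ ℂ S
  have hexp : ∀ x : S, ((NormedSpace.exp x : S) : A) = NormedSpace.exp (x : A) := fun x =>
    NormedSpace.map_exp S.subtype continuous_subtype_val x
  simp [hamiltonianDynamics, hexp]

lemma integrableOn_exp_neg_smul {E : Type*} [NormedAddCommGroup E] [NormedSpace ℝ E] {f : ℝ → E}
    (hf : Continuous f) {C : ℝ} (hC : ∀ t, ‖f t‖ ≤ C) :
    IntegrableOn (fun t => Real.exp (-t) • f t) (Ioi 0) := by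
  refine Integrable.mono' ((integrableOn_exp_neg_Ioi 0).mul_const C)
    (by fun_prop) (Eventually.of_forall fun t => ?_)
  rw [norm_smul, Real.norm_of_nonneg (Real.exp_pos _).le]
  gcongr
  exact hC t

/-- Integration by parts for the Laplace transform at `1` of a bounded orbit. -/
lemma integral_exp_neg_smul_sub {E : Type*} [NormedAddCommGroup E] [NormedSpace ℝ E]
    [CompleteSpace E] {f f' : ℝ → E} (hd : ∀ t, HasDerivAt f (f' t) t) (hf' : Continuous f')
    {C C' : ℝ} (hC : ∀ t, ‖f t‖ ≤ C) (hC' : ∀ t, ‖f' t‖ ≤ C') :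
    ∫ t in Ioi (0 : ℝ), Real.exp (-t) • (f t - f' t) = f 0 := by
  have hf : Continuous f := continuous_iff_continuousAt.2 fun t => (hd t).continuousAt
  have hderiv : ∀ t ∈ Ici (0 : ℝ), HasDerivAt (fun s => -(Real.exp (-s) • f s))
      (Real.exp (-t) • (f t - f' t)) t := by
    intro t _
    have h1 : HasDerivAt (fun s : ℝ => Real.exp (-s)) (-Real.exp (-t)) t := by
      simpa using (hasDerivAt_neg t).exp
    refine (h1.smul (hd t)).neg.congr_deriv ?_
    simp only [smul_sub, neg_smul]
    abel
  have hint : IntegrableOn (fun t => Real.exp (-t) • (f t - f' t)) (Ioi 0) :=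
    integrableOn_exp_neg_smul (hf.sub hf') fun t =>
      (norm_sub_le _ _).trans (add_le_add (hC t) (hC' t))
  have hlim : Tendsto (fun s => -(Real.exp (-s) • f s)) atTop (𝓝 0) := by
    rw [← neg_zero]
    refine Tendsto.neg (squeeze_zero_norm (a := fun s => Real.exp (-s) * C) (fun s => ?_) ?_)
    · rw [norm_smul, Real.norm_of_nonneg (Real.exp_pos _).le]
      gcongr
      exact hC s
    · simpa using Real.tendsto_exp_neg_atTop_nhds_zero.mul_const C
  simpa using integral_Ioi_of_hasDerivAt_of_tendsto' hderiv hint hlim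

/-- The resolvent `(1 - δ)⁻¹ c` of the generator of a Hamiltonian dynamics. -/
noncomputable def hamiltonianResolvent (h c : A) : A :=
  ∫ t in Ioi (0 : ℝ), Real.exp (-t) • hamiltonianDynamics h t c

lemma hasDerivAt_hamiltonianResolvent {h : A} (hh : IsSelfAdjoint h) (c : A) :
    HasDerivAt (fun t => hamiltonianDynamics h t (hamiltonianResolvent h c))
      (hamiltonianResolvent h c - c) 0 := by
  let δ : A →L[ℝ] A := (Complex.I • (ContinuousLinearMap.mul ℂ A h -
    (ContinuousLinearMap.mul ℂ A).flip h)).restrictScalars ℝ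
  have hδ : ∀ a, δ a = Complex.I • (h * a - a * h) := fun a => rfl
  have hcont := continuous_hamiltonianDynamics h c
  have hbound : ∀ t, ‖hamiltonianDynamics h t c‖ ≤ ‖c‖ := fun t =>
    (norm_hamiltonianDynamics hh t c).le
  have hbound' : ∀ t, ‖δ (hamiltonianDynamics h t c)‖ ≤ ‖δ‖ * ‖c‖ := fun t => by
    simpa [norm_hamiltonianDynamics hh] using δ.le_opNorm (hamiltonianDynamics h t c)
  have hint := integrableOn_exp_neg_smul hcont hbound
  have hint' := integrableOn_exp_neg_smul (f := fun t => δ (hamiltonianDynamics h t c))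
    (δ.continuous.comp hcont) hbound'
  have key := integral_exp_neg_smul_sub (f' := fun t => δ (hamiltonianDynamics h t c))
    (fun t => by simpa only [hδ] using hasDerivAt_hamiltonianDynamics h c t)
    (δ.continuous.comp hcont) hbound hbound'
  simp only [smul_sub] at key
  rw [integral_sub hint hint', hamiltonianDynamics_zero] at key
  have hδint : ∫ t in Ioi (0 : ℝ), Real.exp (-t) • δ (hamiltonianDynamics h t c) =
      δ (hamiltonianResolvent h c) := by
    rw [hamiltonianResolvent, ← δ.integral_comp_comm hint]
    simp
  rw [hδint] at key
  have h0 := hasDerivAt_hamiltonianDynamics h (hamiltonianResolvent h c) 0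
  rw [hamiltonianDynamics_zero, ← hδ] at h0
  refine h0.congr_deriv ?_
  have key' : hamiltonianResolvent h c - δ (hamiltonianResolvent h c) = c := key
  generalize hamiltonianResolvent h c = r at key'
  rw [← key', sub_sub_cancel]

lemma coe_hamiltonianResolvent (S : StarSubalgebra ℂ A) [IsClosed (S : Set A)] {h : S}
    (hh : IsSelfAdjoint h) (c : S) :
    ((hamiltonianResolvent h c : S) : A) = hamiltonianResolvent (h : A) (c : A) := by
  let ι : S →L[ℝ] A :=
    { toFun := fun x => x
      map_add' := fun _ _ => rfl
      map_smul' := fun _ _ => rfl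
      cont := continuous_subtype_val }
  have := ι.integral_comp_comm (integrableOn_exp_neg_smul (continuous_hamiltonianDynamics h c)
    fun t => (norm_hamiltonianDynamics hh t c).le)
  change ι _ = _
  rw [hamiltonianResolvent, ← this, hamiltonianResolvent]
  refine integral_congr_ae (Eventually.of_forall fun t => ?_)
  change ι _ = _
  rw [map_smul]
  congr 1
  exact coe_hamiltonianDynamics S h c t

namespace CStarDynamics

lemma norm_aut (τ : CStarDynamics A) (t : ℝ) (a : A) : ‖τ.aut t a‖ = ‖a‖ :=
  StarAlgEquiv.norm_map (τ.aut t) a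

lemma hasDerivAt_aut (τ : CStarDynamics A) {a b : A}
    (hab : HasDerivAt (fun t => τ.aut t a) b 0) (t : ℝ) :
    HasDerivAt (fun t => τ.aut t a) (τ.aut t b) t := by
  let T : A →L[ℝ] A :=
    { toFun := τ.aut t
      map_add' := map_add _
      map_smul' := fun r x => by
        change τ.aut t ((r : ℂ) • x) = (r : ℂ) • τ.aut t x
        exact map_smul (τ.aut t) _ _
      cont := AddMonoidHomClass.continuous_of_bound (τ.aut t) 1 fun x => by
        rw [τ.norm_aut, one_mul] }
  have h1 : HasDerivAt (fun s : ℝ => τ.aut (s - t) a) b t := by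
    rw [← sub_self t] at hab
    exact HasDerivAt.comp_sub_const t t hab
  have he : (fun s => τ.aut s a) = fun s => τ.aut t (τ.aut (s - t) a) := by
    funext s
    rw [← τ.aut_add, add_sub_cancel]
  rw [he]
  exact T.hasFDerivAt.comp_hasDerivAt t h1

/-- An element of the domain of the generator `δ` is the resolvent `(1 - δ)⁻¹` of `(1 - δ) a`. -/
lemma integral_exp_neg_smul_aut (τ : CStarDynamics A) {a b : A}
    (hab : HasDerivAt (fun t => τ.aut t a) b 0) :
    ∫ t in Ioi (0 : ℝ), Real.exp (-t) • τ.aut t (a - b) = a := by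
  simpa [τ.aut_zero] using integral_exp_neg_smul_sub (τ.hasDerivAt_aut hab) (τ.continuous_orbit b)
    (fun t => (τ.norm_aut t a).le) (fun t => (τ.norm_aut t b).le)

end CStarDynamics

/-- Strong convergence of the dynamics implies strong convergence of the resolvents. -/
lemma tendsto_hamiltonianResolvent {τ : CStarDynamics A} {h : ℕ → A}
    (hh : ∀ n, IsSelfAdjoint (h n))
    (hτ : ∀ (t : ℝ) (a : A),
      Tendsto (fun n => ‖hamiltonianDynamics (h n) t a - τ.aut t a‖) atTop (𝓝 0))
    {c : ℕ → A} {c₀ : A} (hc : Tendsto c atTop (𝓝 c₀)) :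
    Tendsto (fun n => hamiltonianResolvent (h n) (c n)) atTop
      (𝓝 (∫ t in Ioi (0 : ℝ), Real.exp (-t) • τ.aut t c₀)) := by
  obtain ⟨C, hC⟩ := (Metric.isBounded_range_of_tendsto c hc).exists_norm_le
  refine tendsto_integral_of_dominated_convergence (fun t => Real.exp (-t) * C)
    (fun n => ?_) ((integrableOn_exp_neg_Ioi 0).mul_const C) (fun n => ?_) ?_
  · have := continuous_hamiltonianDynamics (h n) (c n)
    exact Continuous.aestronglyMeasurable (by fun_prop)
  · refine Eventually.of_forall fun t => ?_
    rw [norm_smul, Real.norm_of_nonneg (Real.exp_pos _).le, norm_hamiltonianDynamics (hh n)]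
    gcongr
    exact hC _ ⟨n, rfl⟩
  · refine Eventually.of_forall fun t => Tendsto.const_smul ?_ _
    have h1 : Tendsto (fun n => hamiltonianDynamics (h n) t (c n - c₀)) atTop (𝓝 0) := by
      rw [tendsto_zero_iff_norm_tendsto_zero]
      simp only [norm_hamiltonianDynamics (hh _)]
      rw [← tendsto_zero_iff_norm_tendsto_zero]
      simpa using hc.sub_const c₀
    have h2 := h1.add (tendsto_iff_norm_sub_tendsto_zero.2 (hτ t c₀))
    simpa [hamiltonianDynamics_sub] using h2

end Resolvent

/-! ### The GNS vector of a state -/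

section GNS

variable {A : Type*} [CStarAlgebra A] [PartialOrder A] [StarOrderedRing A] (ω : A →ₚ[ℂ] ℂ)

lemma gnsStarAlgHom_gnsVector (a : A) :
    ω.gnsStarAlgHom a (gnsVector ω) = ((ω.toPreGNS a : ω.PreGNS) : ω.GNS) := by
  simp [gnsVector]

lemma inner_gnsStarAlgHom_gnsVector (a b : A) :
    inner ℂ (ω.gnsStarAlgHom a (gnsVector ω)) (ω.gnsStarAlgHom b (gnsVector ω)) =
      ω (star a * b) := by
  rw [gnsStarAlgHom_gnsVector, gnsStarAlgHom_gnsVector, UniformSpace.Completion.inner_coe,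
    PositiveLinearMap.preGNS_inner_def]
  simp

lemma norm_sq_gnsStarAlgHom_gnsVector (a : A) :
    ‖ω.gnsStarAlgHom a (gnsVector ω)‖ ^ 2 = (ω (star a * a)).re := by
  rw [← inner_gnsStarAlgHom_gnsVector]
  exact (inner_self_eq_norm_sq (𝕜 := ℂ) _).symm

variable {ω}

lemma IsState.norm_gnsVector (hω : IsState ω) : ‖gnsVector ω‖ = 1 := by
  have h := norm_sq_gnsStarAlgHom_gnsVector ω 1
  rw [map_one, star_one, one_mul, hω] at h
  refine (sq_eq_sq₀ (norm_nonneg _) zero_le_one).1 ?_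
  simpa using h

lemma IsState.norm_apply_le (hω : IsState ω) (a : A) : ‖ω a‖ ≤ ‖a‖ := by
  have h := inner_gnsStarAlgHom_gnsVector ω 1 a
  rw [star_one, one_mul, map_one] at h
  rw [← h]
  refine (norm_inner_le_norm _ _).trans ?_
  simp only [one_apply_eq_self, hω.norm_gnsVector, one_mul]
  refine (ContinuousLinearMap.le_opNorm _ _).trans ?_
  rw [hω.norm_gnsVector, mul_one]
  exact NonUnitalStarAlgHom.norm_apply_le ω.gnsStarAlgHom a

variable (ω)

/-- The GNS vector is cyclic, so the GNS space of a functional on a finite-dimensional algebra is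
the (closed) finite-dimensional space `π(A) Ω`. -/
lemma finiteDimensional_gns [FiniteDimensional ℂ A] : FiniteDimensional ℂ ω.GNS := by
  let f : A →ₗ[ℂ] ω.GNS :=
    (UniformSpace.Completion.toComplₗᵢ (𝕜 := ℂ) (E := ω.PreGNS)).toLinearMap.comp
      ω.toPreGNS.toLinearMap
  have hd : DenseRange f :=
    UniformSpace.Completion.denseRange_coe.comp ω.toPreGNS.surjective.denseRange
      (UniformSpace.Completion.continuous_coe _)
  have hc : IsClosed (f.range : Set ω.GNS) := Submodule.closed_of_finiteDimensional _
  have ht : f.range = ⊤ := by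
    rw [← SetLike.coe_set_eq, ← hc.closure_eq]
    exact hd.closure_range
  exact LinearMap.range_eq_top.1 ht |> Module.Finite.of_surjective f

end GNS

/-! ### Limits of finite-volume ground states -/

section Limit

variable {Λ A : Type*} [CStarAlgebra A]

namespace QuasiLocalStructure

lemma exists_mem_loc_of_mem_iSup (L : QuasiLocalStructure Λ A) {S : Set Λ} {a : A}
    (ha : a ∈ ⨆ X : {X : Finset Λ // (X : Set Λ) ⊆ S}, L.loc X.1) :
    ∃ X : Finset Λ, (X : Set Λ) ⊆ S ∧ a ∈ L.loc X := by
  classical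
  have : Nonempty {X : Finset Λ // (X : Set Λ) ⊆ S} := ⟨⟨∅, by simp⟩⟩
  have hdir : Directed (· ≤ ·) fun X : {X : Finset Λ // (X : Set Λ) ⊆ S} => L.loc X.1 :=
    fun X Y => ⟨⟨X.1 ∪ Y.1, by simpa using ⟨X.2, Y.2⟩⟩,
      L.mono _ _ Finset.subset_union_left, L.mono _ _ Finset.subset_union_right⟩
  rw [← SetLike.mem_coe, StarSubalgebra.coe_iSup_of_directed hdir, Set.mem_iUnion] at ha
  obtain ⟨X, hX⟩ := ha
  exact ⟨X.1, X.2, hX⟩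

lemma exists_mem_loc_dist_lt (L : QuasiLocalStructure Λ A) {S : Set Λ} {a : A}
    (ha : a ∈ L.region S) {ε : ℝ} (hε : 0 < ε) :
    ∃ X : Finset Λ, (X : Set Λ) ⊆ S ∧ ∃ b ∈ L.loc X, dist a b < ε := by
  obtain ⟨b, hb, hab⟩ := Metric.mem_closure_iff.1 ha ε hε
  obtain ⟨X, hX, hbX⟩ := L.exists_mem_loc_of_mem_iSup hb
  exact ⟨X, hX, b, hbX, hab⟩

lemma region_univ (L : QuasiLocalStructure Λ A) : L.region Set.univ = ⊤ := by
  rw [region, ← L.generates]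
  congr 1
  exact le_antisymm (iSup_le fun X => le_iSup L.loc X.1)
    (iSup_le fun X => le_iSup (fun X : {X : Finset Λ // (X : Set Λ) ⊆ Set.univ} => L.loc X.1)
      ⟨X, Set.subset_univ _⟩)

/-- Every element is the limit of elements localised in an exhausting sequence of finite
regions. -/
lemma exists_tendsto_coe (L : QuasiLocalStructure Λ A) {V : ℕ → Finset Λ}
    (hV : Tendsto V atTop atTop) (a : A) :
    ∃ s : ∀ n, L.loc (V n), Tendsto (fun n => (s n : A)) atTop (𝓝 a) := by
  have h1 : ∀ n : ℕ, ∃ s : L.loc (V n), ∀ x ∈ L.loc (V n), dist a s < dist a x + 1 / (n + 1) := by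
    intro n
    have hne : (L.loc (V n) : Set A).Nonempty := ⟨0, zero_mem _⟩
    obtain ⟨s, hs, hlt⟩ := (Metric.infDist_lt_iff hne).1
      (lt_add_of_pos_right (Metric.infDist a (L.loc (V n))) (Nat.one_div_pos_of_nat (n := n)))
    exact ⟨⟨s, hs⟩, fun x hx => hlt.trans_le (by gcongr; exact Metric.infDist_le_dist_of_mem hx)⟩
  choose s hs using h1
  refine ⟨s, tendsto_iff_dist_tendsto_zero.2 ?_⟩
  refine tendsto_order.2 ⟨fun r hr => Eventually.of_forall fun n => hr.trans_le dist_nonneg,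
    fun ε hε => ?_⟩
  obtain ⟨X, -, b, hb, hab⟩ := L.exists_mem_loc_dist_lt (S := Set.univ) (a := a)
    (by rw [L.region_univ]; trivial) (half_pos hε)
  filter_upwards [hV.eventually_ge_atTop X,
    tendsto_one_div_add_atTop_nhds_zero_nat.eventually_lt_const (half_pos hε)] with n hn hn'
  rw [dist_comm]
  linarith [hs n b (L.mono _ _ hn hb)]

end QuasiLocalStructure

/-- A state that is a limit, along an ultrafilter, of ground states of the local dynamics is a
ground state: a vector `a` in the domain of `δ` is the limit of the resolvents
`(1 - δₙ)⁻¹ cₙ` with `cₙ` local and `cₙ → (1 - δ) a`, and these are local, in the domain of `δₙ`,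
with `δₙ aₙ = aₙ - cₙ → δ a`. -/
lemma isGroundState_of_tendsto [PartialOrder A] [StarOrderedRing A]
    (L : QuasiLocalStructure Λ A) (τ : CStarDynamics A)
    {V : ℕ → Finset Λ} (hV : Tendsto V atTop atTop)
    {h : ∀ n, L.loc (V n)} (h_sa : ∀ n, IsSelfAdjoint (h n))
    (hτ : ∀ (t : ℝ) (a : A),
      Tendsto (fun n => ‖hamiltonianDynamics (h n : A) t a - τ.aut t a‖) atTop (𝓝 0))
    {ωn : ∀ n, L.loc (V n) →ₚ[ℂ] ℂ}
    (hωn : ∀ n, IsGroundState (hamiltonianDynamics (h n)) (ωn n))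
    {U : Filter ℕ} [U.NeBot] {φ : A →ₚ[ℂ] ℂ}
    (hφ : ∀ (s : ∀ n, L.loc (V n)) (a : A), Tendsto (fun n => (s n : A)) atTop (𝓝 a) →
      Tendsto (fun n => ωn n (s n)) U (𝓝 (φ a))) :
    IsGroundState (fun t a => τ.aut t a) φ := by
  intro a b hab
  have h_sa' : ∀ n, IsSelfAdjoint (h n : A) := fun n => congrArg Subtype.val (h_sa n)
  obtain ⟨c, hc⟩ := L.exists_tendsto_coe hV (a - b)
  let s : ∀ n, L.loc (V n) := fun n => hamiltonianResolvent (h n) (c n)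
  have hs : Tendsto (fun n => (s n : A)) atTop (𝓝 a) := by
    have := tendsto_hamiltonianResolvent h_sa' hτ hc
    rw [τ.integral_exp_neg_smul_aut hab] at this
    exact this.congr fun n => (coe_hamiltonianResolvent _ (h_sa n) (c n)).symm
  have hsc : Tendsto (fun n => ((star (s n) * (s n - c n) : L.loc (V n)) : A)) atTop
      (𝓝 (star a * b)) := by
    simpa using hs.star.mul (hs.sub hc)
  refine ge_of_tendsto' ((hφ _ _ hsc).const_mul (-Complex.I)) fun n => ?_
  exact hωn n _ _ (hasDerivAt_hamiltonianResolvent (h_sa n) (c n))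

/-- If the infinite-volume ground state is unique, then finite-volume ground states converge to it:
by compactness and uniqueness, along every ultrafilter. -/
lemma tendsto_apply_of_unique_groundState [PartialOrder A] [StarOrderedRing A]
    (L : QuasiLocalStructure Λ A) (τ : CStarDynamics A)
    {V : ℕ → Finset Λ} (hV : Tendsto V atTop atTop)
    {h : ∀ n, L.loc (V n)} (h_sa : ∀ n, IsSelfAdjoint (h n))
    (hτ : ∀ (t : ℝ) (a : A),
      Tendsto (fun n => ‖hamiltonianDynamics (h n : A) t a - τ.aut t a‖) atTop (𝓝 0))
    {ω : A →ₚ[ℂ] ℂ}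
    (hω_unique : ∀ φ : A →ₚ[ℂ] ℂ, IsState φ →
      IsGroundState (fun t a => τ.aut t a) φ → φ = ω)
    {ωn : ∀ n, L.loc (V n) →ₚ[ℂ] ℂ} (hωn_state : ∀ n, IsState (ωn n))
    (hωn : ∀ n, IsGroundState (hamiltonianDynamics (h n)) (ωn n))
    {s : ∀ n, L.loc (V n)} {a : A} (hs : Tendsto (fun n => (s n : A)) atTop (𝓝 a)) :
    Tendsto (fun n => ωn n (s n)) atTop (𝓝 (ω a)) := by
  rw [tendsto_iff_ultrafilter]
  intro U hU
  -- the limit functional is evaluated on chosen local approximants `σ a n → a`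
  choose σ hσ using L.exists_tendsto_coe hV
  have hlim : ∀ a, ∃ z, Tendsto (fun n => ωn n (σ a n)) U (𝓝 z) := by
    intro a
    obtain ⟨C, hC⟩ := (Metric.isBounded_range_of_tendsto _ (hσ a)).exists_norm_le
    obtain ⟨z, -, hz⟩ := (isCompact_closedBall (0 : ℂ) C).ultrafilter_le_nhds
      (U.map fun n => ωn n (σ a n)) (by
        refine tendsto_principal.2 (Eventually.of_forall fun n => ?_)
        rw [mem_closedBall_zero_iff]
        exact ((hωn_state n).norm_apply_le _).trans (hC _ ⟨n, rfl⟩))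
    exact ⟨z, hz⟩
  choose φ₀ hφ₀ using hlim
  have key : ∀ (s : ∀ n, L.loc (V n)) (a : A), Tendsto (fun n => (s n : A)) atTop (𝓝 a) →
      Tendsto (fun n => ωn n (s n)) U (𝓝 (φ₀ a)) := by
    intro s a hs
    have h0 : Tendsto (fun n => ωn n (s n - σ a n)) U (𝓝 0) := by
      have h1 := ((hs.sub (hσ a)).mono_left hU).norm
      rw [sub_self, norm_zero] at h1
      exact squeeze_zero_norm (fun n => (hωn_state n).norm_apply_le _) h1
    simpa using h0.add (hφ₀ a)
  let φ₁ : A →ₗ[ℂ] ℂ :=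
    { toFun := φ₀
      map_add' := fun a b => by
        refine tendsto_nhds_unique (key (fun n => σ a n + σ b n) _ ?_) ?_
        · exact (hσ a).add (hσ b)
        · simpa using (hφ₀ a).add (hφ₀ b)
      map_smul' := fun c a => by
        refine tendsto_nhds_unique (key (fun n => c • σ a n) _ ?_) ?_
        · exact (hσ a).const_smul c
        · simpa using (hφ₀ a).const_smul c }
  let φ : A →ₚ[ℂ] ℂ := PositiveLinearMap.mk₀ φ₁ fun a ha => by
    obtain ⟨b, rfl⟩ := CStarAlgebra.nonneg_iff_eq_star_mul_self.1 ha
    refine ge_of_tendsto' (key (fun n => star (σ b n) * σ b n) _ ?_) fun n =>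
      (ωn n).map_nonneg (star_mul_self_nonneg _)
    exact (hσ b).star.mul (hσ b)
  have hφ_state : IsState φ := by
    refine tendsto_nhds_unique (key (fun n => 1) 1 ?_) ?_
    · exact tendsto_const_nhds
    · simp only [fun n => show ωn n 1 = 1 from hωn_state n]
      exact tendsto_const_nhds
  have hφω : φ = ω := hω_unique φ hφ_state
    (isGroundState_of_tendsto L τ hV h_sa hτ hωn (U := U) key)
  rw [← hφω]
  exact key s a hs

end Limit

/-! ### Amplified representations -/

section Amplification

variable {H : Type*} [NormedAddCommGroup H] [InnerProductSpace ℂ H] {d : ℕ}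

/-- The exchange of the two auxiliary systems of `H ⊗ ℂ^d ⊗ ℂ^d`. -/
noncomputable def amplifiedSwap (H : Type*) [NormedAddCommGroup H] [InnerProductSpace ℂ H] (d : ℕ) :
    Amplified H d ≃ₗᵢ[ℂ] Amplified H d :=
  LinearIsometryEquiv.piLpCongrLeft 2 ℂ H (Equiv.prodComm (Fin d) (Fin d))

@[simp]
lemma amplifiedSwap_apply (ξ : Amplified H d) (p : Fin d × Fin d) :
    amplifiedSwap H d ξ p = ξ p.swap := rfl

lemma norm_tensorVector (Ω : H) (Ψ : EuclideanSpace ℂ (Fin d × Fin d)) :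
    ‖tensorVector Ω Ψ‖ = ‖Ψ‖ * ‖Ω‖ := by
  refine (sq_eq_sq₀ (norm_nonneg _) (by positivity)).1 ?_
  rw [mul_pow, PiLp.norm_sq_eq_of_L2, PiLp.norm_sq_eq_of_L2, Finset.sum_mul]
  simp [tensorVector, norm_smul, mul_pow]

lemma tensorVector_sub (Ω : H) (Ψ Φ : EuclideanSpace ℂ (Fin d × Fin d)) :
    tensorVector Ω (Ψ - Φ) = tensorVector Ω Ψ - tensorVector Ω Φ := by
  ext p
  simp [tensorVector, sub_smul]

variable [CompleteSpace H] {B : Type*} [Ring B] [StarRing B] [Algebra ℂ B]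

/-- The representation `π ⊗ id ⊗ 1` of `B ⊗ M_d(ℂ)` on `H ⊗ ℂ^d ⊗ ℂ^d`, as a map. -/
noncomputable def ampAOperator (π : B →⋆ₐ[ℂ] (H →L[ℂ] H)) (x : Matrix (Fin d) (Fin d) B) :
    Amplified H d →L[ℂ] Amplified H d :=
  ((PiLp.continuousLinearEquiv 2 ℂ (fun _ : Fin d × Fin d => H)).symm : _ →L[ℂ] _).comp
    (ContinuousLinearMap.pi fun p : Fin d × Fin d => ∑ k, (π (x p.1 k)).comp
      (PiLp.proj 2 (fun _ : Fin d × Fin d => H) (k, p.2)))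

lemma ampAOperator_apply (π : B →⋆ₐ[ℂ] (H →L[ℂ] H)) (x : Matrix (Fin d) (Fin d) B)
    (ξ : Amplified H d) (p : Fin d × Fin d) :
    ampAOperator π x ξ p = ∑ k, π (x p.1 k) (ξ (k, p.2)) := by
  simp [ampAOperator]

/-- The representation `π ⊗ id ⊗ 1` of `B ⊗ M_d(ℂ)` on `H ⊗ ℂ^d ⊗ ℂ^d`. -/
noncomputable def ampA (d : ℕ) (π : B →⋆ₐ[ℂ] (H →L[ℂ] H)) :
    Matrix (Fin d) (Fin d) B →⋆ₐ[ℂ] (Amplified H d →L[ℂ] Amplified H d) where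
  toFun := ampAOperator π
  map_one' := by
    ext ξ p
    rw [ampAOperator_apply, Finset.sum_eq_single p.1 (fun k _ hk => by
      simp [Matrix.one_apply_ne hk.symm]) (by simp)]
    simp
  map_mul' x y := by
    ext ξ p
    simp only [ampAOperator_apply, mul_apply_eq_comp, Matrix.mul_apply, map_sum,
      map_mul, sum_apply]
    exact Finset.sum_comm
  map_zero' := by ext ξ p; simp [ampAOperator_apply]
  map_add' x y := by ext ξ p; simp [ampAOperator_apply, Finset.sum_add_distrib]
  commutes' r := by
    ext ξ p
    rw [ampAOperator_apply, Finset.sum_eq_single p.1 (fun k _ hk => by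
      simp [Matrix.algebraMap_matrix_apply, hk.symm]) (by simp)]
    simp [Matrix.algebraMap_matrix_apply, Algebra.algebraMap_eq_smul_one]
  map_star' x := by
    rw [ContinuousLinearMap.star_eq_adjoint]
    refine (ContinuousLinearMap.eq_adjoint_iff _ _).2 fun ξ η => ?_
    simp only [PiLp.inner_apply, ampAOperator_apply, sum_inner, inner_sum, Matrix.star_apply,
      map_star, ContinuousLinearMap.star_eq_adjoint, ContinuousLinearMap.adjoint_inner_left,
      Fintype.sum_prod_type]
    calc _ = ∑ i, ∑ k, ∑ j, inner ℂ (ξ (k, j)) (π (x k i) (η (i, j))) :=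
          Finset.sum_congr rfl fun i _ => Finset.sum_comm
      _ = ∑ k, ∑ i, ∑ j, inner ℂ (ξ (k, j)) (π (x k i) (η (i, j))) := Finset.sum_comm
      _ = _ := Finset.sum_congr rfl fun i _ => Finset.sum_comm

lemma ampA_apply (π : B →⋆ₐ[ℂ] (H →L[ℂ] H)) (x : Matrix (Fin d) (Fin d) B) (ξ : Amplified H d)
    (p : Fin d × Fin d) : ampA d π x ξ p = ∑ k, π (x p.1 k) (ξ (k, p.2)) :=
  ampAOperator_apply π x ξ p

/-- The representation `π ⊗ 1 ⊗ id` of `B ⊗ M_d(ℂ)` on `H ⊗ ℂ^d ⊗ ℂ^d`. -/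
noncomputable def ampB (d : ℕ) (π : B →⋆ₐ[ℂ] (H →L[ℂ] H)) :
    Matrix (Fin d) (Fin d) B →⋆ₐ[ℂ] (Amplified H d →L[ℂ] Amplified H d) :=
  ((amplifiedSwap H d).conjStarAlgEquiv : _ →⋆ₐ[ℂ] _).comp (ampA d π)

lemma ampB_eq (π : B →⋆ₐ[ℂ] (H →L[ℂ] H)) (x : Matrix (Fin d) (Fin d) B) (ξ : Amplified H d) :
    ampB d π x ξ = amplifiedSwap H d (ampA d π x ((amplifiedSwap H d).symm ξ)) := rfl

lemma ampB_apply (π : B →⋆ₐ[ℂ] (H →L[ℂ] H)) (x : Matrix (Fin d) (Fin d) B) (ξ : Amplified H d)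
    (p : Fin d × Fin d) : ampB d π x ξ p = ∑ k, π (x p.2 k) (ξ (p.1, k)) := by
  rw [ampB_eq, amplifiedSwap_apply, ampA_apply]
  rfl

lemma actA_eq_ampA {M : StarSubalgebra ℂ (H →L[ℂ] H)} (u : Matrix (Fin d) (Fin d) M)
    (ξ : Amplified H d) : actA u ξ = ampA d M.subtype u ξ := by
  ext p
  rw [ampA_apply]
  rfl

lemma actB_eq_ampB {M : StarSubalgebra ℂ (H →L[ℂ] H)} (u : Matrix (Fin d) (Fin d) M)
    (ξ : Amplified H d) : actB u ξ = ampB d M.subtype u ξ := by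
  ext p
  rw [ampB_apply]
  rfl

lemma actA_map {M : StarSubalgebra ℂ (H →L[ℂ] H)} (θ : B →⋆ₐ[ℂ] M) (u : Matrix (Fin d) (Fin d) B)
    (ξ : Amplified H d) : actA (u.map θ) ξ = ampA d (M.subtype.comp θ) u ξ := by
  ext p
  rw [ampA_apply]
  rfl

lemma actB_map {M : StarSubalgebra ℂ (H →L[ℂ] H)} (θ : B →⋆ₐ[ℂ] M) (u : Matrix (Fin d) (Fin d) B)
    (ξ : Amplified H d) : actB (u.map θ) ξ = ampB d (M.subtype.comp θ) u ξ := by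
  ext p
  rw [ampB_apply]
  rfl

lemma norm_starAlgHom_unitary_apply {C K : Type*} [NormedAddCommGroup K] [InnerProductSpace ℂ K]
    [CompleteSpace K] [Ring C] [StarRing C] [Algebra ℂ C] (ρ : C →⋆ₐ[ℂ] (K →L[ℂ] K)) {u : C}
    (hu : u ∈ unitary C) (v : K) : ‖ρ u v‖ = ‖v‖ :=
  ContinuousLinearMap.norm_map_of_mem_unitary (Unitary.map_mem ρ hu) v

lemma ampA_ampB_comm {π : B →⋆ₐ[ℂ] (H →L[ℂ] H)} {C : Type*} [Ring C] [StarRing C]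
    [Algebra ℂ C] {π' : C →⋆ₐ[ℂ] (H →L[ℂ] H)} (hcomm : ∀ b c, π b * π' c = π' c * π b)
    (u : Matrix (Fin d) (Fin d) B) (v : Matrix (Fin d) (Fin d) C) (ξ : Amplified H d) :
    ampA d π u (ampB d π' v ξ) = ampB d π' v (ampA d π u ξ) := by
  ext p
  simp only [ampA_apply, ampB_apply, map_sum]
  rw [Finset.sum_comm]
  refine Finset.sum_congr rfl fun k _ => Finset.sum_congr rfl fun l _ => ?_
  exact congrArg (fun T : H →L[ℂ] H => T (ξ (l, k))) (hcomm _ _)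

/-- The embezzlement error is determined by the first columns of the two unitaries. -/
lemma norm_sq_ampA_ampB_sub [NeZero d] (π : B →⋆ₐ[ℂ] (H →L[ℂ] H)) (u v : Matrix (Fin d) (Fin d) B)
    (Ω : H) (Ψ : EuclideanSpace ℂ (Fin d × Fin d)) :
    ‖ampA d π u (ampB d π v (tensorVector Ω (zeroZero d))) - tensorVector Ω Ψ‖ ^ 2 =
      ∑ p, ‖π (u p.1 0 * v p.2 0 - Ψ p • 1) Ω‖ ^ 2 := by
  -- `Ω ⊗ |0⟩|0⟩` has one nonzero component, which selects the first column of each matrix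
  have hv : ∀ p : Fin d × Fin d, ampB d π v (tensorVector Ω (zeroZero d)) p =
      if p.1 = 0 then π (v p.2 0) Ω else 0 := by
    intro p
    rw [ampB_apply, Finset.sum_eq_single 0 (fun k _ hk => by
      simp [tensorVector, zeroZero, hk]) (by simp)]
    by_cases hp : p.1 = 0 <;> simp [tensorVector, zeroZero, hp]
  rw [PiLp.norm_sq_eq_of_L2]
  refine Finset.sum_congr rfl fun p _ => ?_
  congr 2
  rw [PiLp.sub_apply, ampA_apply, Finset.sum_eq_single 0 (fun k _ hk => by
    simp [hv, hk]) (by simp)]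
  rw [hv]
  simp [tensorVector]

/-- Two matrices whose entries agree, up to `c`, on the components of `ξ` act on `ξ` alike. -/
lemma norm_ampA_sub_ampA_le {C : Type*} [Ring C] [StarRing C] [Algebra ℂ C]
    (π : B →⋆ₐ[ℂ] (H →L[ℂ] H)) (π' : C →⋆ₐ[ℂ] (H →L[ℂ] H)) {x : Matrix (Fin d) (Fin d) B}
    {y : Matrix (Fin d) (Fin d) C} {ξ : Amplified H d} {c : ℝ}
    (h : ∀ i j p, ‖π (x i j) (ξ p) - π' (y i j) (ξ p)‖ ≤ c) :
    ‖ampA d π x ξ - ampA d π' y ξ‖ ≤ d * (d * c) := by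
  rcases Nat.eq_zero_or_pos d with rfl | hd
  · rw [Subsingleton.elim (ampA 0 π x ξ) (ampA 0 π' y ξ)]
    simp
  have hc : 0 ≤ c := (norm_nonneg _).trans (h ⟨0, hd⟩ ⟨0, hd⟩ (⟨0, hd⟩, ⟨0, hd⟩))
  have hp : ∀ p, ‖(ampA d π x ξ - ampA d π' y ξ) p‖ ≤ d * c := by
    intro p
    rw [PiLp.sub_apply, ampA_apply, ampA_apply, ← Finset.sum_sub_distrib]
    refine (norm_sum_le_of_le _ fun k _ => h _ _ _).trans ?_
    simp
  refine (sq_le_sq₀ (norm_nonneg _) (by positivity)).1 ?_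
  rw [PiLp.norm_sq_eq_of_L2]
  refine (Finset.sum_le_sum fun p _ => pow_le_pow_left₀ (norm_nonneg _) (hp p) 2).trans ?_
  simp only [Finset.sum_const, Finset.card_univ, Fintype.card_prod, Fintype.card_fin, nsmul_eq_mul]
  push_cast
  exact le_of_eq (by ring)

end Amplification

/-! ### Density of local unitaries -/

section Density

variable {Λ A : Type*} [CStarAlgebra A] {H : Type*} [NormedAddCommGroup H]
  [InnerProductSpace ℂ H] [CompleteSpace H]

/-- Elements of `π(𝒜(S))''` are approximated, on finitely many vectors and together with their
adjoints, by elements localised in finite subregions of `S`. -/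
lemma exists_mem_loc_apply_lt (L : QuasiLocalStructure Λ A) (π : A →⋆ₐ[ℂ] (H →L[ℂ] H)) {S : Set Λ}
    {T : H →L[ℂ] H} (hT : T ∈ doubleCommutant ((L.region S).map π)) {ι : Type*} [Fintype ι]
    (ξ : ι → H) {δ : ℝ} (hδ : 0 < δ) :
    ∃ X : Finset Λ, (X : Set Λ) ⊆ S ∧ ∃ b ∈ L.loc X,
      ∀ i, ‖π b (ξ i) - T (ξ i)‖ < δ ∧ ‖π (star b) (ξ i) - star T (ξ i)‖ < δ := by
  let ξ' : PiLp 2 (fun _ : ι => H) := WithLp.toLp 2 ξ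
  obtain ⟨_, ⟨a, ha, rfl⟩, h1, h2⟩ := exists_mem_diagonalOperator_lt hT ξ' (half_pos hδ)
  obtain ⟨X, hX, b, hb, hab⟩ := L.exists_mem_loc_dist_lt ha
    (ε := δ / 2 / (‖ξ'‖ + 1)) (by positivity)
  have hcomp : ∀ (c : A) (T : H →L[ℂ] H), ‖c‖ < δ / 2 / (‖ξ'‖ + 1) →
      ∀ a : A, ‖diagonalOperator ι (π a) ξ' - diagonalOperator ι T ξ'‖ < δ / 2 →
      ∀ i, ‖π (a - c) (ξ i) - T (ξ i)‖ < δ := by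
    intro c T hc a ha i
    have e1 : ‖π a (ξ i) - T (ξ i)‖ < δ / 2 := (PiLp.norm_apply_le
      (diagonalOperator ι (π a) ξ' - diagonalOperator ι T ξ') i).trans_lt ha
    have e2 : ‖π c (ξ i)‖ < δ / 2 := by
      have hi : ‖ξ i‖ ≤ ‖ξ'‖ := PiLp.norm_apply_le ξ' i
      calc ‖π c (ξ i)‖ ≤ ‖π c‖ * ‖ξ i‖ := (π c).le_opNorm _
        _ ≤ ‖c‖ * ‖ξ'‖ := by
          gcongr
          exact NonUnitalStarAlgHom.norm_apply_le π c
        _ ≤ ‖c‖ * (‖ξ'‖ + 1) := by gcongr; linarith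
        _ < δ / 2 := (lt_div_iff₀ (by positivity)).1 hc
    have e3 : π (a - c) (ξ i) - T (ξ i) = (π a (ξ i) - T (ξ i)) - π c (ξ i) := by
      rw [map_sub, sub_apply]
      abel
    rw [e3]
    exact (norm_sub_le _ _).trans_lt (by linarith)
  rw [dist_eq_norm] at hab
  refine ⟨X, hX, b, hb, fun i => ⟨?_, ?_⟩⟩
  · simpa using hcomp (a - b) T hab a h1 i
  · have := hcomp (star (a - b)) (star T) (by rwa [norm_star]) (star a) (by
      rw [map_star]; exact h2) i
    simpa using this

/-- Unitaries of `π(𝒜(S))'' ⊗ M_d(ℂ)` are approximated, on a vector, by unitaries of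
`𝒜(X) ⊗ M_d(ℂ)` for finite `X ⊆ S`. -/
lemma exists_unitary_loc_ampA_lt (L : QuasiLocalStructure Λ A) (π : A →⋆ₐ[ℂ] (H →L[ℂ] H))
    {S : Set Λ} {d : ℕ}
    {u : Matrix (Fin d) (Fin d) (doubleCommutant ((L.region S).map π))} (hu : u ∈ unitary _)
    (ξ : Amplified H d) {ε : ℝ} (hε : 0 < ε) :
    ∃ X : Finset Λ, (X : Set Λ) ⊆ S ∧ ∃ w ∈ unitary (Matrix (Fin d) (Fin d) (L.loc X)),
      ‖ampA d (π.comp (L.loc X).subtype) w ξ - actA u ξ‖ < ε := by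
  classical
  rw [actA_eq_ampA]
  let M := doubleCommutant ((L.region S).map π)
  let η := ampA d M.subtype u ξ
  have hηξ : ampA d M.subtype (star u) η = ξ := by
    change (ampA d M.subtype (star u) * ampA d M.subtype u) ξ = ξ
    rw [← map_mul, (Unitary.mem_iff.1 hu).1, map_one]
    rfl
  -- `ε / 8` for replacing the entries of `u`, `ε / 8` for making `x` invertible; the polar
  -- decomposition doubles the sum
  let ε' : ℝ := ε / 8 / (d * d + 1)
  have hε' : 0 < ε' := by positivity
  have hdε : (d : ℝ) * (d * ε') ≤ ε / 8 := by
    have h1 : ε' * ((d : ℝ) * d + 1) = ε / 8 := div_mul_cancel₀ _ (by positivity)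
    nlinarith
  choose X hXS b hbX hb using fun i j =>
    exists_mem_loc_apply_lt L π (u i j).2 (Sum.elim ξ η) hε'
  let Y : Finset Λ := Finset.univ.biUnion fun i => Finset.univ.biUnion fun j => X i j
  have hXY : ∀ i j, X i j ⊆ Y := fun i j x hx =>
    Finset.mem_biUnion.2 ⟨i, Finset.mem_univ _, Finset.mem_biUnion.2 ⟨j, Finset.mem_univ _, hx⟩⟩
  have hYS : (Y : Set Λ) ⊆ S := by
    intro x hx
    simp only [Y, Finset.coe_biUnion, Set.mem_iUnion] at hx
    obtain ⟨i, -, j, -, hx⟩ := hx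
    exact hXS i j hx
  let x : Matrix (Fin d) (Fin d) (L.loc Y) := fun i j => ⟨b i j, L.mono _ _ (hXY i j) (hbX i j)⟩
  let ρ := ampA d (π.comp (L.loc Y).subtype)
  have h1 : ‖ρ x ξ - η‖ ≤ ε / 8 :=
    (norm_ampA_sub_ampA_le _ _ fun i j p => (hb i j (Sum.inl p)).1.le).trans hdε
  have h2 : ‖ρ (star x) η - ξ‖ ≤ ε / 8 := by
    conv_lhs => rw [← hηξ]
    exact (norm_ampA_sub_ampA_le _ _ fun i j p => (hb j i (Sum.inr p)).2.le).trans hdε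
  have : FiniteDimensional ℂ (L.loc Y) := L.finiteDimensional Y
  have : FiniteDimensional ℂ (Matrix (Fin d) (Fin d) (L.loc Y)) := inferInstance
  have hηn : ‖η‖ = ‖ξ‖ := norm_starAlgHom_unitary_apply _ hu ξ
  obtain ⟨r, hr0, hr, hunit⟩ := exists_isUnit_add_smul_one x
    (δ := ε / 8 / (‖ξ‖ + 1)) (by positivity)
  have hrξ : r * ‖ξ‖ ≤ ε / 8 := by
    have := (lt_div_iff₀ (by positivity)).1 hr
    nlinarith
  have k1 : ‖ρ (x + (r : ℂ) • (1 : Matrix (Fin d) (Fin d) (L.loc Y))) ξ - η‖ ≤ ε / 4 := by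
    have e1 : ρ (x + (r : ℂ) • (1 : Matrix (Fin d) (Fin d) (L.loc Y))) ξ - η =
        (ρ x ξ - η) + (r : ℂ) • ξ := by
      rw [map_add, map_smul, map_one]
      simp only [add_apply, smul_apply,
        one_apply_eq_self]
      abel
    rw [e1]
    refine (norm_add_le _ _).trans ?_
    rw [norm_smul, Complex.norm_real, Real.norm_of_nonneg hr0.le]
    linarith
  have k2 : ‖ρ (star (x + (r : ℂ) • (1 : Matrix (Fin d) (Fin d) (L.loc Y)))) η - ξ‖ ≤ ε / 4 := by
    have e1 : ρ (star (x + (r : ℂ) • (1 : Matrix (Fin d) (Fin d) (L.loc Y)))) η - ξ =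
        (ρ (star x) η - ξ) + (r : ℂ) • η := by
      rw [star_add, star_smul, star_one, Complex.star_def, Complex.conj_ofReal,
        map_add, map_smul, map_one]
      simp only [add_apply, smul_apply,
        one_apply_eq_self]
      abel
    rw [e1]
    refine (norm_add_le _ _).trans ?_
    rw [norm_smul, Complex.norm_real, Real.norm_of_nonneg hr0.le, hηn]
    linarith
  -- the C⋆-norm on matrices requires an order on the entries
  let _ := CStarAlgebra.spectralOrder (L.loc Y)
  have := CStarAlgebra.spectralOrderedRing (L.loc Y)
  let e := CStarMatrix.ofMatrixStarAlgEquiv (n := Fin d) (A := L.loc Y)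
  obtain ⟨w, hw, hle⟩ := exists_unitary_apply_sub_le
    (ρ.comp (e.symm : CStarMatrix (Fin d) (Fin d) (L.loc Y) →⋆ₐ[ℂ] _))
    (x := e (x + (r : ℂ) • (1 : Matrix (Fin d) (Fin d) (L.loc Y)))) (ξ := ξ) (η := η) (δ := ε / 4)
    (hunit.map e) k1 k2
  exact ⟨Y, hYS, e.symm w, Unitary.map_mem e.symm hw, lt_of_le_of_lt hle (by linarith)⟩

end Density

/-! ### Transfer of embezzlement to finite volumes -/

section Transfer

variable {Λ A : Type*} [CStarAlgebra A]

lemma norm_actA {H : Type*} [NormedAddCommGroup H] [InnerProductSpace ℂ H] [CompleteSpace H]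
    {M : StarSubalgebra ℂ (H →L[ℂ] H)} {d : ℕ} {u : Matrix (Fin d) (Fin d) M}
    (hu : u ∈ unitary (Matrix (Fin d) (Fin d) M)) (ξ : Amplified H d) : ‖actA u ξ‖ = ‖ξ‖ := by
  rw [actA_eq_ampA]
  exact norm_starAlgHom_unitary_apply _ hu ξ

/-- If `u v ζ` is close to `η` for unitaries of the von Neumann algebras of two regions, then the
same holds for unitaries of local algebras. -/
lemma exists_unitary_loc_ampA_ampB_lt (L : QuasiLocalStructure Λ A) {H : Type*}
    [NormedAddCommGroup H] [InnerProductSpace ℂ H] [CompleteSpace H]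
    (π : A →⋆ₐ[ℂ] (H →L[ℂ] H)) {S T : Set Λ} {d : ℕ}
    {M N : StarSubalgebra ℂ (H →L[ℂ] H)} (hM : M = doubleCommutant ((L.region S).map π))
    (hN : N = doubleCommutant ((L.region T).map π))
    {u : Matrix (Fin d) (Fin d) M} (hu : u ∈ unitary (Matrix (Fin d) (Fin d) M))
    {v : Matrix (Fin d) (Fin d) N} (hv : v ∈ unitary (Matrix (Fin d) (Fin d) N))
    {ζ η : Amplified H d} {ε : ℝ} (h : ‖actA u (actB v ζ) - η‖ < ε) :
    ∃ X Y : Finset Λ, (X : Set Λ) ⊆ S ∧ (Y : Set Λ) ⊆ T ∧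
      ∃ u' ∈ unitary (Matrix (Fin d) (Fin d) (L.loc X)),
        ∃ v' ∈ unitary (Matrix (Fin d) (Fin d) (L.loc Y)),
          ‖ampA d (π.comp (L.loc X).subtype) u' (ampB d (π.comp (L.loc Y).subtype) v' ζ) - η‖
            < ε := by
  subst hM hN
  have hs : 0 < (ε - ‖actA u (actB v ζ) - η‖) / 2 := half_pos (sub_pos.2 h)
  obtain ⟨Y, hY, v', hv', hlt⟩ :=
    exists_unitary_loc_ampA_lt L π hv ((amplifiedSwap H d).symm ζ) hs
  set ξ := ampB d (π.comp (L.loc Y).subtype) v' ζ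
  have hvξ : ‖ξ - actB v ζ‖ < (ε - ‖actA u (actB v ζ) - η‖) / 2 := by
    rw [actA_eq_ampA, ← (amplifiedSwap H d).norm_map, map_sub, ← ampB_eq, ← ampB_eq,
      ← actB_eq_ampB] at hlt
    exact hlt
  obtain ⟨X, hX, u', hu', hlt'⟩ := exists_unitary_loc_ampA_lt L π hu ξ hs
  refine ⟨X, Y, hX, hY, u', hu', v', hv', ?_⟩
  have huv : ‖actA u ξ - actA u (actB v ζ)‖ = ‖ξ - actB v ζ‖ := by
    rw [← norm_actA hu (ξ - actB v ζ)]
    simp only [actA_eq_ampA, map_sub]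
  calc _ = ‖(ampA d (π.comp (L.loc X).subtype) u' ξ - actA u ξ) +
        (actA u ξ - actA u (actB v ζ)) + (actA u (actB v ζ) - η)‖ := by congr 1; abel
    _ ≤ _ := norm_add₃_le
    _ < ε := by rw [huv]; linarith

/-- An embezzling vector for the von Neumann algebras of two regions embezzles by local unitaries. -/
lemma IsEmbezzling.exists_unitary_loc {L : QuasiLocalStructure Λ A} {H : Type*}
    [NormedAddCommGroup H] [InnerProductSpace ℂ H] [CompleteSpace H]
    {π : A →⋆ₐ[ℂ] (H →L[ℂ] H)} {S T : Set Λ} {M N : StarSubalgebra ℂ (H →L[ℂ] H)} {Ω : H}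
    (hE : IsEmbezzling M N Ω) (hM : M = doubleCommutant ((L.region S).map π))
    (hN : N = doubleCommutant ((L.region T).map π)) {d : ℕ} [NeZero d] {ε : ℝ} (hε : 0 < ε)
    {Ψ : EuclideanSpace ℂ (Fin d × Fin d)} (hΨ : ‖Ψ‖ = 1) :
    ∃ X Y : Finset Λ, (X : Set Λ) ⊆ S ∧ (Y : Set Λ) ⊆ T ∧
      ∃ u ∈ unitary (Matrix (Fin d) (Fin d) (L.loc X)),
        ∃ v ∈ unitary (Matrix (Fin d) (Fin d) (L.loc Y)),
          ‖ampA d (π.comp (L.loc X).subtype) u (ampB d (π.comp (L.loc Y).subtype) v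
            (tensorVector Ω (zeroZero d))) - tensorVector Ω Ψ‖ < ε := by
  obtain ⟨u, hu, v, hv, huv⟩ := hE d ε hε Ψ hΨ
  exact exists_unitary_loc_ampA_ampB_lt L π hM hN hu hv huv

variable [PartialOrder A] [StarOrderedRing A]

/-- The embezzlement error of given local unitaries is a finite sum of values of the state on local
elements, so it converges when the states do. -/
lemma eventually_norm_ampA_ampB_sub_lt (L : QuasiLocalStructure Λ A) {V : ℕ → Finset Λ}
    (hV : Tendsto V atTop atTop) {ω : A →ₚ[ℂ] ℂ} {ωn : ∀ n, L.loc (V n) →ₚ[ℂ] ℂ}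
    (hlim : ∀ (s : ∀ n, L.loc (V n)) (a : A), Tendsto (fun n => (s n : A)) atTop (𝓝 a) →
      Tendsto (fun n => ωn n (s n)) atTop (𝓝 (ω a)))
    {d : ℕ} [NeZero d] {X Y : Finset Λ} (u : Matrix (Fin d) (Fin d) (L.loc X))
    (v : Matrix (Fin d) (Fin d) (L.loc Y)) (Ψ : EuclideanSpace ℂ (Fin d × Fin d)) {ε : ℝ}
    (h : ‖ampA d (ω.gnsStarAlgHom.comp (L.loc X).subtype) u
        (ampB d (ω.gnsStarAlgHom.comp (L.loc Y).subtype) v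
          (tensorVector (gnsVector ω) (zeroZero d))) - tensorVector (gnsVector ω) Ψ‖ < ε) :
    ∀ᶠ n in atTop, ∀ (hX : X ⊆ V n) (hY : Y ⊆ V n),
      ‖ampA d ((ωn n).gnsStarAlgHom.comp (StarSubalgebra.inclusion (L.mono _ _ hX))) u
        (ampB d ((ωn n).gnsStarAlgHom.comp (StarSubalgebra.inclusion (L.mono _ _ hY))) v
          (tensorVector (gnsVector (ωn n)) (zeroZero d))) -
            tensorVector (gnsVector (ωn n)) Ψ‖ < ε := by
  classical
  have hε : 0 < ε := (norm_nonneg _).trans_lt h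
  let c : Fin d × Fin d → A := fun p => (u p.1 0 : A) * (v p.2 0 : A) - Ψ p • (1 : A)
  let cn : ∀ n, X ⊆ V n → Y ⊆ V n → Fin d × Fin d → L.loc (V n) := fun n hX hY p =>
    StarSubalgebra.inclusion (L.mono _ _ hX) (u p.1 0) *
      StarSubalgebra.inclusion (L.mono _ _ hY) (v p.2 0) - Ψ p • 1
  let s : Fin d × Fin d → ∀ n, L.loc (V n) := fun p n =>
    if hXY : X ⊆ V n ∧ Y ⊆ V n then star (cn n hXY.1 hXY.2 p) * cn n hXY.1 hXY.2 p else 0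
  have hs : ∀ p, Tendsto (fun n => ωn n (s p n)) atTop (𝓝 (ω (star (c p) * c p))) := by
    intro p
    refine hlim _ _ (tendsto_const_nhds.congr' ?_)
    filter_upwards [hV.eventually_ge_atTop X, hV.eventually_ge_atTop Y] with n hX hY
    simp only [s]
    rw [dif_pos ⟨hX, hY⟩]
    rfl
  have hsum : Tendsto (fun n => ∑ p, (ωn n (s p n)).re) atTop
      (𝓝 (∑ p, (ω (star (c p) * c p)).re)) :=
    tendsto_finsetSum _ fun p _ => (Complex.continuous_re.tendsto _).comp (hs p)
  have hω : ∑ p, (ω (star (c p) * c p)).re < ε ^ 2 := by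
    have hsq := pow_lt_pow_left₀ h (norm_nonneg _) two_ne_zero
    have hu : ∀ ξ, ampA d (ω.gnsStarAlgHom.comp (L.loc X).subtype) u ξ =
        ampA d ω.gnsStarAlgHom (u.map (↑)) ξ := fun ξ => by
      ext p; rw [ampA_apply, ampA_apply]; rfl
    have hv : ∀ ξ, ampB d (ω.gnsStarAlgHom.comp (L.loc Y).subtype) v ξ =
        ampB d ω.gnsStarAlgHom (v.map (↑)) ξ := fun ξ => by
      ext p; rw [ampB_apply, ampB_apply]; rfl
    rw [hu, hv, norm_sq_ampA_ampB_sub] at hsq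
    simp only [norm_sq_gnsStarAlgHom_gnsVector] at hsq
    exact hsq
  filter_upwards [hsum.eventually_lt_const hω] with n hn hX hY
  refine lt_of_pow_lt_pow_left₀ 2 hε.le ?_
  have hu : ∀ ξ, ampA d ((ωn n).gnsStarAlgHom.comp (StarSubalgebra.inclusion (L.mono _ _ hX))) u ξ =
      ampA d (ωn n).gnsStarAlgHom (u.map (StarSubalgebra.inclusion (L.mono _ _ hX))) ξ :=
    fun ξ => by ext p; rw [ampA_apply, ampA_apply]; rfl
  have hv : ∀ ξ, ampB d ((ωn n).gnsStarAlgHom.comp (StarSubalgebra.inclusion (L.mono _ _ hY))) v ξ =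
      ampB d (ωn n).gnsStarAlgHom (v.map (StarSubalgebra.inclusion (L.mono _ _ hY))) ξ :=
    fun ξ => by ext p; rw [ampB_apply, ampB_apply]; rfl
  rw [hu, hv, norm_sq_ampA_ampB_sub]
  simp only [norm_sq_gnsStarAlgHom_gnsVector]
  refine lt_of_eq_of_lt (Finset.sum_congr rfl fun p _ => ?_) hn
  simp only [s]
  rw [dif_pos ⟨hX, hY⟩]
  rfl

/-- The representation of a local algebra `𝒜(X)`, with `X` inside `W ∩ S`, by the operators of the
part `S` of the finite system on `W`. -/
noncomputable def gnsLocalHom (L : QuasiLocalStructure Λ A) {W X : Finset Λ}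
    (φ : L.loc W →ₚ[ℂ] ℂ) {S : Set Λ} (hXS : (X : Set Λ) ⊆ S) (hXW : X ⊆ W) :
    L.loc X →⋆ₐ[ℂ] gnsLocalAlgebra L φ S :=
  StarAlgHom.codRestrict (φ.gnsStarAlgHom.comp (StarSubalgebra.inclusion (L.mono _ _ hXW)))
    (gnsLocalAlgebra L φ S) fun a => by
      classical
      refine ⟨StarSubalgebra.inclusion (L.mono _ _ hXW) a, ?_, rfl⟩
      refine L.mono X _ (fun x hx => ?_) a.2
      simpa using ⟨hXW hx, hXS hx⟩

lemma subtype_comp_gnsLocalHom (L : QuasiLocalStructure Λ A) {W X : Finset Λ}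
    (φ : L.loc W →ₚ[ℂ] ℂ) {S : Set Λ} (hXS : (X : Set Λ) ⊆ S) (hXW : X ⊆ W) :
    (gnsLocalAlgebra L φ S).subtype.comp (gnsLocalHom L φ hXS hXW) =
      φ.gnsStarAlgHom.comp (StarSubalgebra.inclusion (L.mono _ _ hXW)) :=
  StarAlgHom.subtype_comp_codRestrict _ _ _

lemma map_mem_unitary_matrix {B C : Type*} [Ring B] [StarRing B] [Algebra ℂ B] [Ring C]
    [StarRing C] [Algebra ℂ C] (θ : B →⋆ₐ[ℂ] C) {d : ℕ} {u : Matrix (Fin d) (Fin d) B}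
    (hu : u ∈ unitary (Matrix (Fin d) (Fin d) B)) :
    u.map θ ∈ unitary (Matrix (Fin d) (Fin d) C) := by
  have hstar : star (u.map θ) = (star u).map θ := by
    ext i j; simp [Matrix.star_apply, map_star]
  rw [Unitary.mem_iff] at hu ⊢
  rw [hstar, ← Matrix.map_mul, ← Matrix.map_mul, hu.1, hu.2]
  simp

/-- Commuting unitaries that embezzle `Ψ` from `Ω` undo the embezzlement by their adjoints. -/
lemma norm_sub_actA_star_actB_star {H : Type*} [NormedAddCommGroup H] [InnerProductSpace ℂ H]
    [CompleteSpace H] {MA MB : StarSubalgebra ℂ (H →L[ℂ] H)} (hM : HaagDuality MA MB) {d : ℕ}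
    {u : Matrix (Fin d) (Fin d) MA} (hu : u ∈ unitary (Matrix (Fin d) (Fin d) MA))
    {v : Matrix (Fin d) (Fin d) MB} (hv : v ∈ unitary (Matrix (Fin d) (Fin d) MB))
    (ζ η : Amplified H d) :
    ‖ζ - actA (star u) (actB (star v) η)‖ = ‖actA u (actB v ζ) - η‖ := by
  have hcomm : ∀ (b : MA) (c : MB), MA.subtype b * MB.subtype c = MB.subtype c * MA.subtype b := by
    intro b c
    have hc : (c : H →L[ℂ] H) ∈ Set.centralizer (MA : Set (H →L[ℂ] H)) := hM ▸ c.2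
    exact Set.mem_centralizer_iff.1 hc b b.2
  simp only [actA_eq_ampA, actB_eq_ampB]
  have e : ζ - ampA d MA.subtype (star u) (ampB d MB.subtype (star v) η) =
      ampA d MA.subtype (star u) (ampB d MB.subtype (star v)
        (ampA d MA.subtype u (ampB d MB.subtype v ζ) - η)) := by
    rw [ampA_ampB_comm hcomm, map_sub, map_sub,
      ← ampA_ampB_comm hcomm (star u) (star v) η]
    congr 1
    have hA : ∀ ξ, ampA d MA.subtype (star u) (ampA d MA.subtype u ξ) = ξ := fun ξ => by
      rw [← mul_apply_eq_comp, ← map_mul, (Unitary.mem_iff.1 hu).1, map_one]; rfl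
    have hB : ∀ ξ, ampB d MB.subtype (star v) (ampB d MB.subtype v ξ) = ξ := fun ξ => by
      rw [← mul_apply_eq_comp, ← map_mul, (Unitary.mem_iff.1 hv).1, map_one]; rfl
    rw [← ampA_ampB_comm hcomm u, hB, hA]
  rw [e, norm_starAlgHom_unitary_apply _ (Unitary.star_mem hu),
    norm_starAlgHom_unitary_apply _ (Unitary.star_mem hv)]

end Transfer

section FiniteVolume

lemma norm_sub_actA_actB_lt_of_dist_lt {H : Type*} [NormedAddCommGroup H] [InnerProductSpace ℂ H]
    [CompleteSpace H] {MA MB : StarSubalgebra ℂ (H →L[ℂ] H)} {Ω : H} (hΩ : ‖Ω‖ = 1) {d : ℕ}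
    {u : Matrix (Fin d) (Fin d) MA} (hu : u ∈ unitary (Matrix (Fin d) (Fin d) MA))
    {v : Matrix (Fin d) (Fin d) MB} (hv : v ∈ unitary (Matrix (Fin d) (Fin d) MB))
    {ζ : Amplified H d} {Φ Ψ : EuclideanSpace ℂ (Fin d × Fin d)} {δ δ' : ℝ}
    (h : ‖ζ - actA u (actB v (tensorVector Ω Φ))‖ < δ) (hd : dist Ψ Φ < δ') :
    ‖ζ - actA u (actB v (tensorVector Ω Ψ))‖ < δ + δ' := by
  have e : ‖actA u (actB v (tensorVector Ω Φ)) - actA u (actB v (tensorVector Ω Ψ))‖ < δ' := by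
    simp only [actA_eq_ampA, actB_eq_ampB]
    rw [← map_sub, ← map_sub, norm_starAlgHom_unitary_apply _ hu,
      norm_starAlgHom_unitary_apply _ hv, ← tensorVector_sub, norm_tensorVector, hΩ, mul_one,
      ← dist_eq_norm, dist_comm]
    exact hd
  exact (norm_sub_le_norm_sub_add_norm_sub _ _ _).trans_lt (add_lt_add h e)

/-- If finite-volume states converge to a state with embezzling GNS vector, then every fixed vector
`Ψ` is embezzled in all large enough finite volumes. -/
lemma eventually_exists_unitary_gnsLocalAlgebra {Λ A : Type*} [CStarAlgebra A] [PartialOrder A]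
    [StarOrderedRing A] (L : QuasiLocalStructure Λ A) {ΛA ΛB : Set Λ} {V : ℕ → Finset Λ}
    (hV : Tendsto V atTop atTop) {ω : A →ₚ[ℂ] ℂ} {ωn : ∀ n, L.loc (V n) →ₚ[ℂ] ℂ}
    (hlim : ∀ (s : ∀ n, L.loc (V n)) (a : A), Tendsto (fun n => (s n : A)) atTop (𝓝 a) →
      Tendsto (fun n => ωn n (s n)) atTop (𝓝 (ω a)))
    (hω : IsEmbezzling (gnsRegionAlgebra L ω ΛA) (gnsRegionAlgebra L ω ΛB) (gnsVector ω))
    (hωn_haag : ∀ n,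
      HaagDuality (gnsLocalAlgebra L (ωn n) ΛA) (gnsLocalAlgebra L (ωn n) ΛB))
    {d : ℕ} [NeZero d] {ε : ℝ} (hε : 0 < ε) {Ψ : EuclideanSpace ℂ (Fin d × Fin d)}
    (hΨ : ‖Ψ‖ = 1) :
    ∀ᶠ n in atTop, ∃ u ∈ unitary (Matrix (Fin d) (Fin d) (gnsLocalAlgebra L (ωn n) ΛA)),
      ∃ v ∈ unitary (Matrix (Fin d) (Fin d) (gnsLocalAlgebra L (ωn n) ΛB)),
        ‖tensorVector (gnsVector (ωn n)) (zeroZero d) -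
          actA u (actB v (tensorVector (gnsVector (ωn n)) Ψ))‖ < ε := by
  have hloc := hω.exists_unitary_loc (L := L) (S := ΛA) (T := ΛB)
    (π := ω.gnsStarAlgHom) rfl rfl hε hΨ
  obtain ⟨X, Y, hX, hY, u, hu, v, hv, huv⟩ := hloc
  filter_upwards [eventually_norm_ampA_ampB_sub_lt L hV hlim u v Ψ huv,
    hV.eventually_ge_atTop X, hV.eventually_ge_atTop Y] with n hn hXn hYn
  have hU := map_mem_unitary_matrix (gnsLocalHom L (ωn n) hX hXn) hu
  have hW := map_mem_unitary_matrix (gnsLocalHom L (ωn n) hY hYn) hv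
  refine ⟨_, Unitary.star_mem hU, _, Unitary.star_mem hW, ?_⟩
  rw [norm_sub_actA_star_actB_star (hωn_haag n) hU hW, actA_map, actB_map,
    subtype_comp_gnsLocalHom, subtype_comp_gnsLocalHom]
  exact hn hXn hYn

/-- By compactness of the unit sphere, embezzlement of each fixed vector from all late members of a
sequence is uniform in the vector. -/
lemma exists_forall_le_of_eventually_exists_unitary {H : ℕ → Type*}
    [∀ n, NormedAddCommGroup (H n)] [∀ n, InnerProductSpace ℂ (H n)] [∀ n, CompleteSpace (H n)]
    {MA MB : ∀ n, StarSubalgebra ℂ (H n →L[ℂ] H n)} {Ω : ∀ n, H n} (hΩ : ∀ n, ‖Ω n‖ = 1)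
    {d : ℕ} [NeZero d] {ε : ℝ} (hε : 0 < ε)
    (h : ∀ Ψ : EuclideanSpace ℂ (Fin d × Fin d), ‖Ψ‖ = 1 → ∀ᶠ n in atTop,
      ∃ u ∈ unitary (Matrix (Fin d) (Fin d) (MA n)),
        ∃ v ∈ unitary (Matrix (Fin d) (Fin d) (MB n)),
          ‖tensorVector (Ω n) (zeroZero d) - actA u (actB v (tensorVector (Ω n) Ψ))‖ < ε / 2) :
    ∃ N : ℕ, ∀ n, N ≤ n → ∀ Ψ : EuclideanSpace ℂ (Fin d × Fin d), ‖Ψ‖ = 1 →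
      ∃ u ∈ unitary (Matrix (Fin d) (Fin d) (MA n)),
        ∃ v ∈ unitary (Matrix (Fin d) (Fin d) (MB n)),
          ‖tensorVector (Ω n) (zeroZero d) - actA u (actB v (tensorVector (Ω n) Ψ))‖ < ε := by
  obtain ⟨t, ht, htfin, hcover⟩ := finite_cover_balls_of_compact
    (isCompact_sphere (0 : EuclideanSpace ℂ (Fin d × Fin d)) 1) (half_pos hε)
  obtain ⟨N, hN⟩ := eventually_atTop.1 ((eventually_all_finite htfin).2 fun Ψ hΨt =>
    h Ψ (mem_sphere_zero_iff_norm.1 (ht hΨt)))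
  refine ⟨N, fun n hn Ψ hΨ => ?_⟩
  obtain ⟨Φ, hΦt, hΦ⟩ := Set.mem_iUnion₂.1 (hcover (mem_sphere_zero_iff_norm.2 hΨ))
  obtain ⟨u, hu, v, hv, huv⟩ := hN n hn Φ hΦt
  refine ⟨u, hu, v, hv, ?_⟩
  have hlt := norm_sub_actA_actB_lt_of_dist_lt (hΩ n) hu hv huv hΦ
  rwa [add_halves] at hlt

end FiniteVolume

theorem mainTheorem4 {Λ A : Type*} [CStarAlgebra A] [PartialOrder A] [StarOrderedRing A]
    (L : QuasiLocalStructure Λ A)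
    (ΛA ΛB : Set Λ) (hAB : IsCompl ΛA ΛB)
    -- the infinite-volume dynamics, the finite regions and their Hamiltonians
    (τ : CStarDynamics A)
    (V : ℕ → Finset Λ) (hV : Tendsto V atTop atTop)
    (h : ∀ n, L.loc (V n)) (h_sa : ∀ n, IsSelfAdjoint (h n))
    (hτ : ∀ (t : ℝ) (a : A),
      Tendsto (fun n => ‖hamiltonianDynamics (h n : A) t a - τ.aut t a‖) atTop (𝓝 0))
    -- the unique infinite-volume ground state, which is embezzling
    (ω : A →ₚ[ℂ] ℂ) (hω_state : IsState ω)
    (hω_ground : IsGroundState (fun t a => τ.aut t a) ω)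
    (hω_unique : ∀ φ : A →ₚ[ℂ] ℂ, IsState φ →
      IsGroundState (fun t a => τ.aut t a) φ → φ = ω)
    (hω_faithful : Function.Injective ω.gnsStarAlgHom)
    (hω_haag : HaagDuality (gnsRegionAlgebra L ω ΛA) (gnsRegionAlgebra L ω ΛB))
    (hω_embezzling :
      IsEmbezzling (gnsRegionAlgebra L ω ΛA) (gnsRegionAlgebra L ω ΛB) (gnsVector ω))
    -- pure finite-volume ground states
    (ωn : ∀ n, L.loc (V n) →ₚ[ℂ] ℂ) (hωn_pure : ∀ n, IsPureState (ωn n))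
    (hωn_ground : ∀ n, IsGroundState (hamiltonianDynamics (h n)) (ωn n))
    (hωn_haag : ∀ n,
      HaagDuality (gnsLocalAlgebra L (ωn n) ΛA) (gnsLocalAlgebra L (ωn n) ΛB)) :
    ∃ k : ℕ → ℕ, StrictMono k ∧
      IsBipartiteEmbezzlingFamily
        (fun j => gnsLocalAlgebra L (ωn (k j)) ΛA)
        (fun j => gnsLocalAlgebra L (ωn (k j)) ΛB)
        (fun j => gnsVector (ωn (k j))) := by
  have hωn_state : ∀ n, IsState (ωn n) := fun n => (hωn_pure n).1
  have hlim : ∀ (s : ∀ n, L.loc (V n)) (a : A), Tendsto (fun n => (s n : A)) atTop (𝓝 a) →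
      Tendsto (fun n => ωn n (s n)) atTop (𝓝 (ω a)) := fun s a hs =>
    tendsto_apply_of_unique_groundState L τ hV h_sa hτ hω_unique hωn_state hωn_ground hs
  -- the whole sequence converges, so no index has to be dropped
  refine ⟨id, strictMono_id, ?_, hωn_haag, fun n => (hωn_state n).norm_gnsVector, ?_⟩
  · intro n
    have : FiniteDimensional ℂ (L.loc (V n)) := L.finiteDimensional (V n)
    exact finiteDimensional_gns (ωn n)
  intro d _ ε hε
  exact exists_forall_le_of_eventually_exists_unitary (fun n => (hωn_state n).norm_gnsVector) hε
    fun Ψ hΨ => eventually_exists_unitary_gnsLocalAlgebra L hV hlim hω_embezzling hωn_haag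
      (half_pos hε) hΨ
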